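/- Let $n \ge 1$ and $k \ge 3$ be integers, let $H$ be the complete $k$-uniform hypergraph on the vertex set $\{1,\dots,n\}$ (its hyperedges are all $k$-element subsets), and let $$A \;=\; \mathbb{C}[x_1,\dots,x_n]\,/\,\bigl(x_{i_1}\cdots x_{i_k} : \{i_1,\dots,i_k\}\text{ a hyperedge of } H\bigr).$$ For $m \ge 0$ let $HC_m(A)$ be the cyclic homology of $A$ over $\mathbb{C}$, that is, the $m$-th homology of Connes' complex $C^\lambda_m(A) = A^{\otimes (m+1)}/\operatorname{im}(1-t)$, where $t(a_0\otimes\cdots\otimes a_m) = (-1)^m a_m\otimes a_0\otimes\cdots\otimes a_{m-1}$ and the differential is induced by the Hochschild boundary $b$. Let $HC_m(A)^{\mathrm{mult}} \subseteq HC_m(A)$ be the multilinear part, i.e. the component of multidegree $(1,\dots,1)$ in $x_1,\dots,x_n$: the classes represented by cycles in the span of the tensors of monomials in which every variable occurs exactly once in total. Index the groups by $r = m-1$, so that the $r$-th group is the homology at the chains with $r+2$ tensor factors. Then for every integer $r \ge 0$: (a) if $n-k < r \le n-2$, then $\displaystyle \dim_{\mathbb{C}} HC_{r+1}(A)^{\mathrm{mult}}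 = \binom{n-1}{r+1}$; (b) if $r = n-k$, then $\displaystyle \dim_{\mathbb{C}} HC_{r+1}(A)^{\mathrm{mult}} = \binom{n-1}{n-k-1} + \binom{n-1}{n-k+1}$, where $\binom{a}{j} = 0$ for $j < 0$. -/

import Mathlib

open scoped TensorProduct

noncomputable section

namespace CyclicHom

/-! ## Cyclic homology of an algebra over a ring containing ℚ, by the Connes complex

For a unital `R`-algebra `A` (with `ℚ ⊆ R`), the group `HC_m(A)` is the `m`-th homology of the
complex `A^{⊗(m+1)} / (1 - t)` with differential induced by the Hochschild boundary `b`. -/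

section Connes

variable (R : Type*) [CommRing R] (A : Type*) [Ring A] [Algebra R A]

/-- Hochschild chains `A^{⊗(m+1)} = A ⊗ ⋯ ⊗ A` (`m + 1` factors). -/
abbrev Chain (m : ℕ) : Type _ := ⨂[R] _i : Fin (m + 1), A

variable {A} in
/-- The `i`-th face on words: for `i ≤ m`, multiply neighbours,
`(a_0, …, a_{m+1}) ↦ (a_0, …, a_i a_{i+1}, …, a_{m+1})`; for `i = m + 1`,
`(a_0, …, a_{m+1}) ↦ (a_{m+1} a_0, a_1, …, a_m)`. -/
def faceFun {m : ℕ} (i : Fin (m + 2)) (a : Fin (m + 2) → A) : Fin (m + 1) → A :=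
  if i = Fin.last (m + 1) then
    Function.update (fun j : Fin (m + 1) => a j.castSucc) 0 (a (Fin.last (m + 1)) * a 0)
  else Fin.contractNth i (· * ·) a

theorem faceFun_update {m : ℕ} (i : Fin (m + 2)) (a : Fin (m + 2) → A) (p : Fin (m + 2)) :
    ∃ (q : Fin (m + 1)) (L : A →ₗ[R] A),
      ∀ x, faceFun i (Function.update a p x) = Function.update (faceFun i a) q (L x) := by
  by_cases hi : i = Fin.last (m + 1)
  · subst hi
    by_cases hp : p = Fin.last (m + 1)
    · subst hp
      refine ⟨0, LinearMap.mulRight R (a 0), fun x => ?_⟩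
      funext j
      by_cases hj : j = 0
      · subst hj
        simp [faceFun]
      · simp [faceFun, hj]
    · by_cases hp0 : p = 0
      · subst hp0
        refine ⟨0, LinearMap.mulLeft R (a (Fin.last (m + 1))), fun x => ?_⟩
        funext j
        by_cases hj : j = 0
        · subst hj; simp [faceFun]
        · simp [faceFun, hj]
      · refine ⟨p.castPred hp, LinearMap.id, fun x => ?_⟩
        funext j
        by_cases hj : j = 0
        · subst hj
          have h1 : (0 : Fin (m + 2)) ≠ p := fun h => hp0 h.symm
          have h2 : (0 : Fin (m + 1)) ≠ p.castPred hp := by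
            intro h; apply h1; simpa using congrArg Fin.castSucc h
          have h3 : Fin.last (m + 1) ≠ p := fun h => hp h.symm
          simp [faceFun, Function.update_apply, h1, h2, h3]
        · simp only [faceFun, if_true, Function.update_apply, hj, if_false, LinearMap.id_apply,
            Fin.ext_iff, Fin.val_castSucc, Fin.coe_castPred]
  · have hi' : (i : ℕ) < m + 1 := Fin.val_lt_last hi
    have hp := p.isLt
    rcases lt_trichotomy (p : ℕ) i with h | h | h
    · refine ⟨⟨p, by omega⟩, LinearMap.id, fun x => ?_⟩
      funext j
      simp only [faceFun, hi, if_false, Fin.contractNth, Function.update_apply, Fin.ext_iff,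
        Fin.val_castSucc, Fin.val_succ, LinearMap.id_apply]
      split_ifs <;> first | rfl | omega
    · refine ⟨⟨i, by omega⟩, LinearMap.mulRight R (a ⟨i + 1, by omega⟩), fun x => ?_⟩
      funext j
      simp only [faceFun, hi, if_false, Fin.contractNth, Function.update_apply, Fin.ext_iff,
        Fin.val_castSucc, Fin.val_succ, LinearMap.mulRight_apply]
      split_ifs with h1 h2 h3 h4 h5 <;> first | rfl | omega | skip
      all_goals first
        | (congr 2; ext; simp; omega)
    · by_cases h' : (p : ℕ) = i + 1
      · refine ⟨⟨i, by omega⟩, LinearMap.mulLeft R (a i), fun x => ?_⟩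
        funext j
        simp only [faceFun, hi, if_false, Fin.contractNth, Function.update_apply, Fin.ext_iff,
          Fin.val_castSucc, Fin.val_succ, LinearMap.mulLeft_apply]
        split_ifs <;> first | rfl | omega | skip
        all_goals first
          | (congr 2; ext; simp; omega)
      · refine ⟨⟨p - 1, by omega⟩, LinearMap.id, fun x => ?_⟩
        funext j
        simp only [faceFun, hi, if_false, Fin.contractNth, Function.update_apply, Fin.ext_iff,
          Fin.val_castSucc, Fin.val_succ, LinearMap.id_apply]
        split_ifs <;> first | rfl | omega

/-- The `i`-th face as a multilinear map into the tensor power. -/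
def faceMultilinear (m : ℕ) (i : Fin (m + 2)) :
    MultilinearMap R (fun _ : Fin (m + 2) => A) (Chain R A m) where
  toFun a := PiTensorProduct.tprod R (faceFun i a)
  map_update_add' := by
    intro dec a p x y
    obtain rfl : dec = instDecidableEqFin _ := Subsingleton.elim _ _
    obtain ⟨q, L, h⟩ := faceFun_update R A i a p
    rw [h, h, h, map_add, MultilinearMap.map_update_add]
  map_update_smul' := by
    intro dec a p c x
    obtain rfl : dec = instDecidableEqFin _ := Subsingleton.elim _ _
    obtain ⟨q, L, h⟩ := faceFun_update R A i a p
    rw [h, h, map_smul, MultilinearMap.map_update_smul]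

/-- The `i`-th face map `d_i : A^{⊗(m+2)} → A^{⊗(m+1)}`. -/
def face (m : ℕ) (i : Fin (m + 2)) : Chain R A (m + 1) →ₗ[R] Chain R A m :=
  PiTensorProduct.lift (faceMultilinear R A m i)

theorem face_tprod (m : ℕ) (i : Fin (m + 2)) (a : Fin (m + 2) → A) :
    face R A m i (PiTensorProduct.tprod R a) = PiTensorProduct.tprod R (faceFun i a) := by
  simp [face, faceMultilinear]

/-- The Hochschild boundary `b = ∑_{i=0}^{m+1} (-1)^i d_i`. -/
def hochschildB (m : ℕ) : Chain R A (m + 1) →ₗ[R] Chain R A m :=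
  ∑ i : Fin (m + 2), ((-1 : R) ^ (i : ℕ)) • face R A m i

/-- The signed cyclic operator
`t (a_0 ⊗ ⋯ ⊗ a_m) = (-1)^m a_m ⊗ a_0 ⊗ ⋯ ⊗ a_{m-1}`. -/
def cyclicT (m : ℕ) : Chain R A m →ₗ[R] Chain R A m :=
  ((-1 : R) ^ m) • (PiTensorProduct.reindex R (fun _ => A) (finRotate (m + 1))).toLinearMap

theorem cyclicT_tprod (m : ℕ) (a : Fin (m + 1) → A) :
    cyclicT R A m (PiTensorProduct.tprod R a) =
      ((-1 : R) ^ m) • PiTensorProduct.tprod R (fun i => a (i - 1)) := by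
  simp only [cyclicT, LinearMap.smul_apply, LinearEquiv.coe_coe, PiTensorProduct.reindex_tprod,
    finRotate_symm_apply]

variable {A} in
theorem faceFun_zero_rotate {m : ℕ} (a : Fin (m + 2) → A) :
    faceFun 0 (fun i => a (i - 1)) = faceFun (Fin.last (m + 1)) a := by
  have hs : ∀ j : Fin (m + 1), (j.succ - 1 : Fin (m + 2)) = j.castSucc := by
    intro j; rw [sub_eq_iff_eq_add]; simp
  have h0 : (0 - 1 : Fin (m + 2)) = Fin.last (m + 1) := by
    rw [sub_eq_iff_eq_add]; simp
  have hl : (0 : Fin (m + 2)) ≠ Fin.last (m + 1) := Fin.last_pos.ne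
  funext j
  by_cases hj : j = 0
  · subst hj
    simp [faceFun, Fin.contractNth, hl, h0]
  · have hj' : (j : ℕ) ≠ 0 := fun h => hj (Fin.ext h)
    simp [faceFun, Fin.contractNth, hl, hj, hs]

variable {A} in
theorem faceFun_succ_rotate {m : ℕ} (i : Fin (m + 1)) (a : Fin (m + 2) → A) :
    faceFun i.succ (fun j => a (j - 1)) = fun j => faceFun i.castSucc a (j - 1) := by
  have hs : ∀ j : Fin (m + 1), (j.succ - 1 : Fin (m + 2)) = j.castSucc := by
    intro j; rw [sub_eq_iff_eq_add]; simp
  have h0 : (0 - 1 : Fin (m + 2)) = Fin.last (m + 1) := by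
    rw [sub_eq_iff_eq_add]; simp
  have h0' : (0 - 1 : Fin (m + 1)) = Fin.last m := by
    rw [sub_eq_iff_eq_add]; simp
  have hc : i.castSucc ≠ Fin.last (m + 1) := (Fin.castSucc_lt_last i).ne
  have him := i.isLt
  funext j
  cases j using Fin.cases with
  | zero =>
    rw [h0']
    by_cases hi : i = Fin.last m
    · subst hi
      have hl : (Fin.last (m + 1) - 1 : Fin (m + 2)) = (Fin.last m).castSucc := hs (Fin.last m)
      simp [faceFun, Fin.contractNth, h0, hl, hc]
    · have hi' : i.succ ≠ Fin.last (m + 1) := by simpa [← Fin.succ_last] using hi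
      have hlt : (i : ℕ) < m := Fin.val_lt_last hi
      simp [faceFun, Fin.contractNth, h0, hi', hc, show ¬ m < (i : ℕ) by omega,
        show ¬ m = (i : ℕ) by omega]
  | succ j =>
    cases m with
    | zero => exact j.elim0
    | succ m =>
      have hs' : (j.succ - 1 : Fin (m + 2)) = j.castSucc := by
        rw [sub_eq_iff_eq_add]; simp
      have hjm := j.isLt
      rw [hs']
      by_cases hi : i = Fin.last (m + 1)
      · subst hi
        simp [faceFun, Fin.contractNth, hs, hc, show (j : ℕ) ≤ m by omega]
      · have hi' : i.succ ≠ Fin.last (m + 2) := by simpa [← Fin.succ_last] using hi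
        simp [faceFun, Fin.contractNth, hs, hi', hc]

/-- The image of `1 - t`. -/
def cyclicRelations (m : ℕ) : Submodule R (Chain R A m) :=
  LinearMap.range (LinearMap.id - cyclicT R A m)

theorem cyclicRelations_le_comap (m : ℕ) :
    cyclicRelations R A (m + 1) ≤ (cyclicRelations R A m).comap (hochschildB R A m) := by
  have key : hochschildB R A m ∘ₗ (LinearMap.id - cyclicT R A (m + 1)) =
      (LinearMap.id - cyclicT R A m) ∘ₗ
        (∑ i : Fin (m + 1), ((-1 : R) ^ (i : ℕ)) • face R A m i.castSucc) := by
    refine PiTensorProduct.ext (MultilinearMap.ext fun a => ?_)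
    simp only [LinearMap.compMultilinearMap_apply, LinearMap.comp_apply, LinearMap.sub_apply,
      LinearMap.id_apply, map_sub, map_smul, cyclicT_tprod, hochschildB, LinearMap.sum_apply,
      LinearMap.smul_apply, face_tprod, map_sum]
    rw [Fin.sum_univ_castSucc]
    rw [Fin.sum_univ_succ
      (f := fun i : Fin (m + 2) => (-1 : R) ^ (i : ℕ) •
        PiTensorProduct.tprod R (faceFun i fun j => a (j - 1)))]
    simp only [faceFun_zero_rotate, faceFun_succ_rotate, Fin.val_castSucc, Fin.val_last,
      Fin.val_zero, Fin.val_succ, pow_zero, one_smul, smul_sub, smul_add, Finset.smul_sum,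
      Finset.sum_sub_distrib, smul_smul]
    rw [add_comm ((-1 : R) ^ (m + 1) • _), add_sub_add_right_eq_sub]
    congr 1
    refine Finset.sum_congr rfl fun i _ => ?_
    congr 1
    ring
  rintro _ ⟨x, rfl⟩
  exact ⟨_, (LinearMap.congr_fun key x).symm⟩

/-- The module of Connes (cyclic) chains `A^{⊗(m+1)} / (1 - t)`. -/
abbrev CyclicChain (m : ℕ) : Type _ := Chain R A m ⧸ cyclicRelations R A m

/-- The differential of the Connes complex, induced by the Hochschild boundary. -/
def cyclicBoundary (m : ℕ) : CyclicChain R A (m + 1) →ₗ[R] CyclicChain R A m :=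
  Submodule.mapQ _ _ (hochschildB R A m) (cyclicRelations_le_comap R A m)

/-- Cycles of the Connes complex; in degree `0` every chain is a cycle. -/
def cyclicCycles : (m : ℕ) → Submodule R (CyclicChain R A m)
  | 0 => ⊤
  | m + 1 => LinearMap.ker (cyclicBoundary R A m)

/-- Boundaries of the Connes complex. -/
def cyclicBoundaries (m : ℕ) : Submodule R (CyclicChain R A m) :=
  LinearMap.range (cyclicBoundary R A m)

/-- The `m`-th cyclic homology `HC_m(A)`: cycles modulo boundaries in
`A^{⊗(m+1)} / (1 - t)`. -/
abbrev HC (m : ℕ) : Type _ :=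
  cyclicCycles R A m ⧸ (cyclicBoundaries R A m).submoduleOf (cyclicCycles R A m)

end Connes

/-! ## The quotient ring of a hypergraph and the multilinear part -/

/-- The complete `k`-uniform hypergraph on the vertex set `Fin n`: the hyperedges are all subsets
of size `k`. -/
def completeUniform (n k : ℕ) : Hypergraph (Fin n) where
  vertexSet := Set.univ
  edgeSet := {e | e.ncard = k}
  subset_vertexSet_of_mem_edgeSet' := fun _ _ => Set.subset_univ _

/-- The ideal generated by the monomials `∏_{i ∈ e} x_i`, `e` a hyperedge of `H`. -/
def edgeIdeal {n : ℕ} (H : Hypergraph (Fin n)) : Ideal (MvPolynomial (Fin n) ℂ) :=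
  Ideal.span {p | ∃ e : Finset (Fin n), (e : Set (Fin n)) ∈ H.edgeSet ∧
    p = ∏ i ∈ e, MvPolynomial.X i}

/-- The ring `ℂ[x_1, …, x_n] / (∏_{i ∈ e} x_i : e a hyperedge of H)`. -/
abbrev EdgeRing {n : ℕ} (H : Hypergraph (Fin n)) : Type :=
  MvPolynomial (Fin n) ℂ ⧸ edgeIdeal H

/-- The multilinear part of `A^{⊗(m+1)}`, `A = EdgeRing H`: the component of multidegree
`(1, …, 1)`, spanned by the tensors `x^{d_0} ⊗ ⋯ ⊗ x^{d_m}` of classes of monomials in which each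
variable occurs exactly once in total. -/
def multilinearChains {n : ℕ} (H : Hypergraph (Fin n)) (m : ℕ) :
    Submodule ℂ (Chain ℂ (EdgeRing H) m) :=
  Submodule.span ℂ {c | ∃ d : Fin (m + 1) → (Fin n →₀ ℕ),
    (∀ j : Fin n, ∑ i, d i j = 1) ∧
    c = PiTensorProduct.tprod ℂ
      (fun i => Ideal.Quotient.mk (edgeIdeal H) (MvPolynomial.monomial (d i) (1 : ℂ)))}

/-- The multilinear part of `HC_m(EdgeRing H)`: the classes that are represented by cycles of
multidegree `(1, …, 1)`. -/
def multilinearHC {n : ℕ} (H : Hypergraph (Fin n)) (m : ℕ) :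
    Submodule ℂ (HC ℂ (EdgeRing H) m) :=
  Submodule.map (Submodule.mkQ _)
    (((multilinearChains H m).map (cyclicRelations ℂ (EdgeRing H) m).mkQ).submoduleOf
      (cyclicCycles ℂ (EdgeRing H) m))

/-- The binomial coefficient `binom(a, j)` with an integer lower index, zero for `j < 0`. -/
def binom (a : ℕ) (j : ℤ) : ℕ := if 0 ≤ j then a.choose j.toNat else 0

end CyclicHom

end

/-! Put `n = N + 1`. A multilinear tensor of monomials with `m + 1` factors is a distribution of the
`n` variables over `m + 1` cyclically ordered slots. The cyclic quotient is used up by rotating the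
first variable into slot `0`, so only a map `Fin N → Fin (m + 1)` remains. The Hochschild faces
merge neighbouring slots, and these maps are the `m`-simplices of the `N`-fold power of the
simplicial circle. The tensors that vanish in the ring are the crowded distributions, with at least
`k` variables in one slot; they span a subcomplex. The multilinear cyclic homology is therefore the
homology of the torus `(S^1)^N` relative to the crowded subcomplex.

The homology of the torus in degree `m` has dimension `N.choose m`: the cocycles `placing e` and the
cycles `antisym e`, for increasing `e`, are dual bases (`exists_slotBoundary_eq`,
`placing_antisym`). Degenerate distributions, with an empty slot other than `0`, do not contribute
(`exists_slotBoundary_eq_of_degenerate`). By pigeonhole every crowded distribution is degenerate in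
degrees above `t = n - k`, so the crowded homology vanishes there. In degree `t` a nondegenerate
crowded distribution is a `k`-element slot together with `t` singletons. Since `3 ≤ k`, a cycle must
be alternating in the singletons up to cyclic rotation, so its homology class is determined by one
coefficient for each `t`-subset of the variables (`mem_degenerate_of_coeff`), and the
antisymmetrizations realize all of these. The crowded homology in degree `t` thus has dimension
`n.choose t`, and it maps onto that of the torus.

The long exact sequence gives `N.choose (r + 1)` for `r > t`, and for `r = t` it gives `N.choose (t
+ 1) + n.choose t - N.choose t`, which Pascal's rule simplifies. -/

namespace CyclicHom

/-! ### Distributions over slots and their boundary -/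

/-- Merging the cyclically neighbouring slots `i` and `i + 1` of `m + 2` slots; for `i = m + 1` the
last slot is merged into slot `0`. -/
def merge (m i : ℕ) (x : Fin (m + 2)) : Fin (m + 1) :=
  ⟨if (x : ℕ) ≤ i then (if (x : ℕ) = m + 1 then 0 else x) else x - 1, by
    have := x.isLt
    split_ifs <;> omega⟩

theorem merge_val (m i : ℕ) (x : Fin (m + 2)) : (merge m i x : ℕ) =
    if (x : ℕ) ≤ i then (if (x : ℕ) = m + 1 then 0 else (x : ℕ)) else (x : ℕ) - 1 := rfl

/-- This is the simplicial identity `d_i d_j = d_{j-1} d_i` in the simplicial circle, whose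
`m`-simplices are the slots, with slot `0` as base point. -/
theorem merge_comm (m : ℕ) {i j : ℕ} (hij : i < j) (hj : j ≤ m + 2) (x : Fin (m + 3)) :
    merge m i (merge (m + 1) j x) = merge m (j - 1) (merge (m + 1) i x) := by
  apply Fin.ext
  simp only [merge_val]
  split_ifs <;> omega

/-- Formal combinations of the distributions of the elements of `ι` over `m + 1` slots. -/
abbrev SlotChain (ι : Type*) (m : ℕ) : Type _ := (ι → Fin (m + 1)) →₀ ℂ

/-- The Hochschild boundary on distributions. -/
noncomputable def slotBoundary (ι : Type*) (m : ℕ) : SlotChain ι (m + 1) →ₗ[ℂ] SlotChain ι m :=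
  ∑ i ∈ Finset.range (m + 2), ((-1 : ℂ) ^ i) • Finsupp.lmapDomain ℂ ℂ (fun g => merge m i ∘ g)

theorem slotBoundary_single {ι : Type*} (m : ℕ) (g : ι → Fin (m + 2)) :
    slotBoundary ι m (Finsupp.single g 1) =
      ∑ i ∈ Finset.range (m + 2), Finsupp.single (merge m i ∘ g) ((-1 : ℂ) ^ i) := by
  simp [slotBoundary, LinearMap.sum_apply, Finsupp.mapDomain_single]

theorem SlotChain.hom_ext {ι V : Type*} {m : ℕ} [AddCommMonoid V] [Module ℂ V]
    {f g : SlotChain ι m →ₗ[ℂ] V}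
    (h : ∀ c, f (Finsupp.single c 1) = g (Finsupp.single c 1)) : f = g :=
  Finsupp.lhom_ext' fun c => LinearMap.ext_ring (h c)

/-- The involution that exchanges `(j, i)`, `i < j`, with `(i, j - 1)` pairs equal values of
opposite sign. This is the cancellation behind `∂² = 0`. -/
theorem sum_alternating_eq_zero {V : Type*} [AddCommGroup V] [Module ℂ V] (M : ℕ)
    (F : ℕ → ℕ → V) (hF : ∀ i j, i < j → j ≤ M → F i j = F (j - 1) i) :
    ∑ j ∈ Finset.range (M + 1), ∑ i ∈ Finset.range M, ((-1 : ℂ) ^ (j + i)) • F i j = 0 := by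
  rw [← Finset.sum_product']
  refine Finset.sum_involution
    (fun p _ => if p.2 < p.1 then (p.2, p.1 - 1) else (p.2 + 1, p.1)) ?_ ?_ ?_ ?_
  · rintro ⟨j, i⟩ h
    simp only [Finset.mem_product, Finset.mem_range] at h
    dsimp only
    split_ifs with hij
    · rw [hF i j hij (by omega)]
      obtain ⟨j, rfl⟩ : ∃ l, j = l + 1 := ⟨j - 1, by omega⟩
      simp only [Nat.add_sub_cancel, ← add_smul]
      rw [show ((-1 : ℂ) ^ (j + 1 + i) + (-1) ^ (i + j)) = 0 by ring, zero_smul]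
    · rw [hF j (i + 1) (by omega) (by omega)]
      simp only [Nat.add_sub_cancel, ← add_smul]
      rw [show ((-1 : ℂ) ^ (j + i) + (-1) ^ (i + 1 + j)) = 0 by ring, zero_smul]
  · rintro ⟨j, i⟩ h _
    dsimp only
    split_ifs with hij <;> simp only [ne_eq, Prod.mk.injEq] <;> omega
  · rintro ⟨j, i⟩ h
    simp only [Finset.mem_product, Finset.mem_range] at h
    dsimp only
    split_ifs with hij <;> simp only [Finset.mem_product, Finset.mem_range] <;> omega
  · rintro ⟨j, i⟩ h
    dsimp only
    by_cases hij : i < j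
    · simp only [hij, if_true]
      rw [if_neg (by omega)]
      simp only [Prod.mk.injEq, and_true]
      omega
    · simp only [hij, if_false]
      rw [if_pos (by omega)]
      simp

theorem slotBoundary_slotBoundary {ι : Type*} (m : ℕ) (c : SlotChain ι (m + 2)) :
    slotBoundary ι m (slotBoundary ι (m + 1) c) = 0 := by
  suffices h : slotBoundary ι m ∘ₗ slotBoundary ι (m + 1) = 0 from LinearMap.congr_fun h c
  refine SlotChain.hom_ext fun g => ?_
  rw [LinearMap.comp_apply, slotBoundary_single, map_sum, LinearMap.zero_apply]
  rw [← sum_alternating_eq_zero (m + 2)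
    (fun i j => (Finsupp.single (merge m i ∘ merge (m + 1) j ∘ g) 1 : SlotChain ι m))]
  · refine Finset.sum_congr rfl fun j _ => ?_
    rw [← mul_one ((-1 : ℂ) ^ j), ← smul_eq_mul, ← Finsupp.smul_single, map_smul,
      slotBoundary_single, Finset.smul_sum]
    refine Finset.sum_congr rfl fun i _ => ?_
    simp [pow_add]
  · intro i j hij hj
    congr 1
    funext x
    exact merge_comm m hij hj (g x)

/-- Splitting two alternating sums at position `j`, as in `∂ s + s ∂`. -/
theorem sum_range_add_sum_range {V : Type*} [AddCommGroup V] (A B : ℕ → V) {j m : ℕ}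
    (hj : j ≤ m) :
    ∑ i ∈ Finset.range (m + 2), A i + ∑ i ∈ Finset.range (m + 1), B i =
      ∑ i ∈ Finset.range j, (A i + B i) + (A j + A (j + 1) + B j) +
        ∑ i ∈ Finset.Ico (j + 1) (m + 1), (A (i + 1) + B i) := by
  obtain ⟨d, rfl⟩ := Nat.exists_eq_add_of_le hj
  rw [Finset.sum_Ico_eq_sum_range]
  clear hj
  induction d with
  | zero =>
    simp only [add_zero, Finset.sum_range_succ, Finset.sum_add_distrib, Nat.sub_self,
      Finset.sum_range_zero]
    abel
  | succ d ih =>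
    rw [show j + (d + 1) + 2 = (j + d + 2) + 1 by omega,
      show j + (d + 1) + 1 = (j + d + 1) + 1 by omega, Finset.sum_range_succ A,
      Finset.sum_range_succ B, show j + d + 1 + 1 - (j + 1) = (j + d + 1 - (j + 1)) + 1 by omega,
      Finset.sum_range_succ _ (j + d + 1 - (j + 1)), ← add_assoc _ _ (A _ + B _), ← ih,
      show j + 1 + (j + d + 1 - (j + 1)) = j + d + 1 by omega]
    rw [show j + d + 1 + 1 = j + d + 2 by omega]
    abel

/-! ### The cocycles of the torus -/

/-- The functional that counts the distributions with `e a` in slot `a + 1` for all `a`. -/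
noncomputable def placing {ι : Type*} {m : ℕ} (e : Fin m → ι) : SlotChain ι m →ₗ[ℂ] ℂ :=
  open Classical in
  Finsupp.lsum ℂ fun g => if ∀ a, g (e a) = a.succ then LinearMap.id else 0

open Classical in
theorem placing_single {ι : Type*} {m : ℕ} (e : Fin m → ι) (g : ι → Fin (m + 1)) (z : ℂ) :
    placing e (Finsupp.single g z) = if ∀ a, g (e a) = a.succ then z else 0 := by
  simp only [placing, Finsupp.lsum_single]
  split_ifs <;> rfl

/-- The functional is the cup product of the 1-cocycles of the circles `e a`. Concretely, a face has
the values `1, …, m` along `e` only if `g` has the values `1, …, m + 1` with one omitted. If `j + 1`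
is omitted, exactly the faces `j` and `j + 1` qualify, with opposite signs. -/
theorem placing_slotBoundary {ι : Type*} {m : ℕ} (e : Fin m → ι) (c : SlotChain ι (m + 1)) :
    placing e (slotBoundary ι m c) = 0 := by
  classical
  suffices h : placing e ∘ₗ slotBoundary ι m = 0 from LinearMap.congr_fun h c
  refine SlotChain.hom_ext fun g => ?_
  rw [LinearMap.comp_apply, slotBoundary_single, map_sum, LinearMap.zero_apply]
  simp only [placing_single, Function.comp_apply]
  -- `S j`: the values along `e` are `1, …, m + 1` without `j + 1`
  let S : ℕ → Prop := fun j =>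
    ∀ a : Fin m, (g (e a) : ℕ) = if (a : ℕ) < j then (a : ℕ) + 1 else (a : ℕ) + 2
  have key : ∀ i ≤ m + 1, (∀ a, merge m i (g (e a)) = a.succ) ↔
      ((i ≠ 0 ∧ S (i - 1)) ∨ (i ≤ m ∧ S i)) := by
    intro i hi
    simp only [Fin.ext_iff, merge_val, Fin.val_succ, S]
    constructor
    · intro h
      by_cases h0 : i = 0
      · refine Or.inr ⟨by omega, fun a => ?_⟩
        have := h a; split_ifs at this ⊢ <;> omega
      by_cases h1 : ∃ a : Fin m, (a : ℕ) + 1 = i ∧ (g (e a) : ℕ) = i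
      · obtain ⟨a, ha, hg⟩ := h1
        refine Or.inr ⟨by omega, fun b => ?_⟩
        by_cases hb : b = a
        · subst hb; rw [if_pos (by omega)]; omega
        · have hb' : (b : ℕ) ≠ a := fun h => hb (Fin.ext h)
          have := h b; split_ifs at this ⊢ <;> omega
      · push Not at h1
        refine Or.inl ⟨h0, fun b => ?_⟩
        have := h b
        have := h1 b
        split_ifs at * <;> omega
    · rintro (⟨h0, h⟩ | ⟨h0, h⟩) a <;> have := h a <;> have := (g (e a)).isLt <;>
        have := a.isLt <;> split_ifs at * <;> omega
  have excl : ∀ i, i ≠ 0 → i ≤ m → S (i - 1) → S i → False := by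
    intro i h0 him h1 h2
    have h3 := h1 ⟨i - 1, by omega⟩
    have h4 := h2 ⟨i - 1, by omega⟩
    simp only at h3 h4
    split_ifs at h3 h4 <;> omega
  have hterm : ∀ i ∈ Finset.range (m + 2),
      (if ∀ a, merge m i (g (e a)) = a.succ then (-1 : ℂ) ^ i else 0) =
        (if i ≠ 0 ∧ S (i - 1) then (-1 : ℂ) ^ i else 0) +
          (if i ≤ m ∧ S i then (-1 : ℂ) ^ i else 0) := by
    intro i hi
    rw [Finset.mem_range] at hi
    rw [if_congr (key i (by omega)) rfl rfl]
    by_cases h1 : i ≠ 0 ∧ S (i - 1)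
    · have h2 : ¬ (i ≤ m ∧ S i) := fun h2 => excl i h1.1 h2.1 h1.2 h2.2
      rw [if_pos (Or.inl h1), if_pos h1, if_neg h2, add_zero]
    · rw [if_neg h1, zero_add, if_congr (or_iff_right h1) rfl rfl]
  -- Shifting the first sum by one index makes both sums run over the omitted value; the extreme
  -- terms vanish and the others cancel.
  rw [Finset.sum_congr rfl hterm, Finset.sum_add_distrib, Finset.sum_range_succ',
    Finset.sum_range_succ (n := m + 1)]
  rw [if_neg (by simp : ¬ ((0 : ℕ) ≠ 0 ∧ S (0 - 1))), if_neg (by omega : ¬ (m + 1 ≤ m ∧ S (m + 1))),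
    add_zero, add_zero, ← Finset.sum_add_distrib]
  refine Finset.sum_eq_zero fun i hi => ?_
  rw [Finset.mem_range] at hi
  by_cases h : S i
  · rw [if_pos ⟨by omega, by simpa using h⟩, if_pos ⟨by omega, h⟩]; ring
  · rw [if_neg (by simp [h]), if_neg (by simp [h])]; ring

/-- Inserting an empty slot at position `j`. -/
def insertSlot (m j : ℕ) (x : Fin (m + 1)) : Fin (m + 2) :=
  ⟨if (x : ℕ) < j then x else x + 1, by have := x.isLt; split_ifs <;> omega⟩

theorem insertSlot_val (m j : ℕ) (x : Fin (m + 1)) :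
    (insertSlot m j x : ℕ) = if (x : ℕ) < j then (x : ℕ) else (x : ℕ) + 1 := rfl

/-! ### Homology of the torus, one circle at a time -/

section Torus

variable {N : ℕ}

/-- Removing the element `0` if it lies in slot `1`, and then merging the slots `0` and `1`. -/
noncomputable def removeFirst (N m : ℕ) :
    SlotChain (Fin (N + 1)) (m + 1) →ₗ[ℂ] SlotChain (Fin N) m :=
  Finsupp.linearCombination ℂ fun f =>
    if (f 0 : ℕ) = 1 then Finsupp.single (merge m 0 ∘ Fin.tail f) 1 else 0

/-- Inserting a new slot `1` that contains only the new element `0`. -/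
noncomputable def insertFirst (N m : ℕ) :
    SlotChain (Fin N) m →ₗ[ℂ] SlotChain (Fin (N + 1)) (m + 1) :=
  Finsupp.linearCombination ℂ fun g =>
    Finsupp.single (Fin.cons 1 (insertSlot m 1 ∘ g) : Fin (N + 1) → Fin (m + 2)) 1

/-- Moving the element `0` out of its slot, into a new slot on the right. -/
noncomputable def moveFirst (N m : ℕ) :
    SlotChain (Fin (N + 1)) m →ₗ[ℂ] SlotChain (Fin (N + 1)) (m + 1) :=
  Finsupp.linearCombination ℂ fun f =>
    if (f 0 : ℕ) = 0 then 0 else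
      Finsupp.single (Fin.cons (f 0).succ (insertSlot m (f 0 + 1) ∘ Fin.tail f) :
        Fin (N + 1) → Fin (m + 2)) ((-1 : ℂ) ^ (f 0 : ℕ))

/-- Chains in which the element `0` is in slot `0` or in a slot from `j` on. -/
noncomputable def firstFrom (N m j : ℕ) : Submodule ℂ (SlotChain (Fin (N + 1)) m) :=
  Finsupp.supported ℂ ℂ {f | (f 0 : ℕ) = 0 ∨ j ≤ (f 0 : ℕ)}

theorem single_mem_firstFrom {m j : ℕ} {f : Fin (N + 1) → Fin (m + 1)} {z : ℂ}
    (h : (f 0 : ℕ) = 0 ∨ j ≤ (f 0 : ℕ)) : Finsupp.single f z ∈ firstFrom N m j :=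
  Finsupp.single_mem_supported ℂ z h

theorem removeFirst_insertFirst (m : ℕ) (c : SlotChain (Fin N) m) :
    removeFirst N m (insertFirst N m c) = c := by
  suffices h : removeFirst N m ∘ₗ insertFirst N m = LinearMap.id from LinearMap.congr_fun h c
  refine SlotChain.hom_ext fun g => ?_
  simp only [LinearMap.comp_apply, insertFirst, removeFirst, Finsupp.linearCombination_single,
    one_smul, LinearMap.id_apply, Fin.cons_zero, Fin.val_one, if_true, Fin.tail_cons]
  congr 1
  funext x
  apply Fin.ext
  simp only [Function.comp_apply, merge_val, insertSlot_val]
  have := (g x).isLt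
  split_ifs <;> omega

/-- This is the cap product with the 1-cocycle of the first circle. If the element `0` is in slot
`1`, face `0` loses it, and face `i + 1` becomes face `i` after the removal, which accounts for the
sign. If it is in slot `2`, only faces `0` and `1` bring it to slot `1`, and they cancel. -/
theorem removeFirst_slotBoundary (m : ℕ) (c : SlotChain (Fin (N + 1)) (m + 2)) :
    removeFirst N m (slotBoundary _ (m + 1) c) = -slotBoundary _ m (removeFirst N (m + 1) c) := by
  suffices h : removeFirst N m ∘ₗ slotBoundary _ (m + 1) =
      -(slotBoundary _ m ∘ₗ removeFirst N (m + 1)) from LinearMap.congr_fun h c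
  refine SlotChain.hom_ext fun f => ?_
  rw [LinearMap.comp_apply, slotBoundary_single, map_sum, LinearMap.neg_apply,
    LinearMap.comp_apply]
  simp only [removeFirst, Finsupp.linearCombination_single, one_smul, Function.comp_apply,
    merge_val]
  have htail : ∀ i, Fin.tail (merge (m + 1) i ∘ f) = merge (m + 1) i ∘ Fin.tail f := fun i => rfl
  simp only [htail]
  have hz := (f 0).isLt
  by_cases h1 : (f 0 : ℕ) = 1
  · rw [if_pos h1, slotBoundary_single, Finset.sum_range_succ', ← Finset.sum_neg_distrib]
    have h0 : ((-1 : ℂ) ^ 0 • if (if (f 0 : ℕ) ≤ 0 then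
        if (f 0 : ℕ) = m + 1 + 1 then 0 else (f 0 : ℕ) else (f 0 : ℕ) - 1) = 1
        then (Finsupp.single (merge m 0 ∘ merge (m + 1) 0 ∘ Fin.tail f) 1 : SlotChain (Fin N) m)
        else 0) = 0 := by
      rw [if_neg (by split_ifs <;> omega), smul_zero]
    rw [h0, add_zero]
    refine Finset.sum_congr rfl fun i hi => ?_
    rw [if_pos (by split_ifs <;> omega), Finsupp.smul_single, ← Finsupp.single_neg, smul_eq_mul,
      mul_one, pow_succ, mul_neg_one]
    congr 1
    funext x
    rw [Finset.mem_range] at hi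
    exact merge_comm m (by omega) (by omega) _
  · rw [if_neg h1, map_zero, neg_zero]
    by_cases h2 : (f 0 : ℕ) = 2
    · rw [Finset.sum_range_succ', Finset.sum_range_succ', Finset.sum_eq_zero, zero_add]
      · rw [if_pos (by split_ifs <;> omega), if_pos (by split_ifs <;> omega)]
        have : merge m 0 ∘ merge (m + 1) (0 + 1) ∘ Fin.tail f =
            merge m 0 ∘ merge (m + 1) 0 ∘ Fin.tail f := by
          funext x
          exact merge_comm m (by omega) (by omega) _
        rw [this, ← add_smul]
        norm_num
      · intro i _
        split_ifs <;> first | (exfalso; omega) | exact smul_zero _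
    · refine Finset.sum_eq_zero fun i hi => ?_
      rw [Finset.mem_range] at hi
      split_ifs <;> first | (exfalso; omega) | exact smul_zero _

theorem removeFirst_eq_zero {m j : ℕ} (hj : 2 ≤ j) {c : SlotChain (Fin (N + 1)) (m + 1)}
    (hc : c ∈ firstFrom N (m + 1) j) : removeFirst N m c = 0 := by
  have : firstFrom N (m + 1) j ≤ LinearMap.ker (removeFirst N m) := by
    rw [firstFrom, Finsupp.supported_eq_span_single, Submodule.span_le]
    rintro _ ⟨f, hf, rfl⟩
    simp only [Set.mem_ofPred_eq] at hf
    simp only [SetLike.mem_coe, LinearMap.mem_ker, removeFirst, Finsupp.linearCombination_single]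
    rw [if_neg (by omega), smul_zero]
  exact this hc

/-- The homotopy pushes the element `0` from its slot `z` to the next one. Face `z` after the move
restores the chain. Face `z + 1` after the move, and face `z` before it, leave the element in slot
`z + 1` or in slot `0`. All other faces cancel between the two composites, except at the passage
from slot `1` to slot `0`, which is the correction term. -/
theorem moveFirst_homotopy {m j : ℕ} {c : SlotChain (Fin (N + 1)) (m + 1)}
    (hc : c ∈ firstFrom N (m + 1) j) :
    slotBoundary _ (m + 1) (moveFirst N (m + 1) c) + moveFirst N m (slotBoundary _ m c) - c +
      insertFirst N m (removeFirst N m c) ∈ firstFrom N (m + 1) (j + 1) := by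
  suffices h : firstFrom N (m + 1) j ≤ (firstFrom N (m + 1) (j + 1)).comap
      (slotBoundary _ (m + 1) ∘ₗ moveFirst N (m + 1) + moveFirst N m ∘ₗ slotBoundary _ m -
        LinearMap.id + insertFirst N m ∘ₗ removeFirst N m) from h hc
  conv_lhs => rw [firstFrom, Finsupp.supported_eq_span_single]
  rw [Submodule.span_le]
  rintro _ ⟨f, hf, rfl⟩
  simp only [Set.mem_ofPred_eq] at hf
  simp only [SetLike.mem_coe, Submodule.mem_comap, LinearMap.add_apply, LinearMap.sub_apply,
    LinearMap.comp_apply, LinearMap.id_apply]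
  obtain ⟨z, g, rfl⟩ : ∃ z g, f = Fin.cons z g := ⟨f 0, Fin.tail f, (Fin.cons_self_tail f).symm⟩
  rw [Fin.cons_zero] at hf
  have hcomp : ∀ (l i : ℕ) (z : Fin (l + 2)) (g : Fin N → Fin (l + 2)),
      merge l i ∘ (Fin.cons z g : Fin (N + 1) → Fin (l + 2)) =
        Fin.cons (merge l i z) (merge l i ∘ g) := by
    intro l i z g
    funext x
    cases x using Fin.cases <;> rfl
  have hz := z.isLt
  have hmove : ∀ (l : ℕ) (z : Fin (l + 1)) (g : Fin N → Fin (l + 1)) (r : ℂ),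
      moveFirst N l (Finsupp.single (Fin.cons z g) r) = if (z : ℕ) = 0 then 0 else
        Finsupp.single (Fin.cons z.succ (insertSlot l (z + 1) ∘ g) : Fin (N + 1) → Fin (l + 2))
          (r * (-1 : ℂ) ^ (z : ℕ)) := by
    intro l z g r
    simp only [moveFirst, Finsupp.linearCombination_single, Fin.cons_zero, Fin.tail_cons]
    split_ifs <;> simp
  have hrem : removeFirst N m (Finsupp.single (Fin.cons z g) 1) =
      if (z : ℕ) = 1 then Finsupp.single (merge m 0 ∘ g) 1 else 0 := by
    simp only [removeFirst, Finsupp.linearCombination_single, Fin.cons_zero, Fin.tail_cons,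
      one_smul]
  rw [hmove, hrem, slotBoundary_single, map_sum]
  simp only [hcomp, hmove]
  -- No merging takes the element `0` out of slot `0`, so for `z = 0` both composites vanish.
  by_cases h0 : (z : ℕ) = 0
  · rw [if_pos h0, map_zero, zero_add, if_neg (by omega), map_zero, add_zero,
      Finset.sum_eq_zero, zero_sub]
    · exact Submodule.neg_mem _ (single_mem_firstFrom (Or.inl h0))
    · intro i _
      rw [if_pos]
      rw [merge_val]
      split_ifs <;> omega
  rw [if_neg h0, one_mul, ← mul_one ((-1 : ℂ) ^ (z : ℕ)), ← smul_eq_mul ((-1 : ℂ) ^ (z : ℕ)),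
    ← Finsupp.smul_single, map_smul, slotBoundary_single, Finset.smul_sum]
  simp only [hcomp]
  rw [sum_range_add_sum_range (j := (z : ℕ)) _ _ (by omega)]
  -- For `z = 1`, face `0` puts the element into slot `0`, where `moveFirst` is zero, so face `0` of
  -- the moved distribution has no partner. For larger `z` all pairs cancel.
  have hlow : ∑ i ∈ Finset.range (z : ℕ),
      ((-1 : ℂ) ^ (z : ℕ) • Finsupp.single (Fin.cons (merge (m + 1) i z.succ)
        (merge (m + 1) i ∘ insertSlot (m + 1) (z + 1) ∘ g) : Fin (N + 1) → Fin (m + 2))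
        ((-1 : ℂ) ^ i) +
      if (merge m i z : ℕ) = 0 then 0 else
        Finsupp.single (Fin.cons (merge m i z).succ
          (insertSlot m (merge m i z + 1) ∘ merge m i ∘ g) : Fin (N + 1) → Fin (m + 2))
          ((-1 : ℂ) ^ i * (-1 : ℂ) ^ (merge m i z : ℕ))) =
      -insertFirst N m (if (z : ℕ) = 1 then Finsupp.single (merge m 0 ∘ g) 1 else 0) := by
    by_cases h1 : (z : ℕ) = 1
    · rw [h1, Finset.sum_range_one, if_pos (by rw [merge_val]; split_ifs <;> omega), if_pos rfl,
        add_zero, insertFirst, Finsupp.linearCombination_single, one_smul, Finsupp.smul_single,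
        ← Finsupp.single_neg]
      congr 1
      · congr 1
        · apply Fin.ext
          rw [merge_val, Fin.val_succ, Fin.val_one]
          split_ifs <;> omega
        · funext x
          apply Fin.ext
          simp only [Function.comp_apply, merge_val, insertSlot_val]
          have := (g x).isLt
          split_ifs <;> omega
      · simp
    · rw [if_neg h1, map_zero, neg_zero]
      refine Finset.sum_eq_zero fun i hi => ?_
      rw [Finset.mem_range] at hi
      have hm : (merge m i z : ℕ) = z - 1 := by rw [merge_val]; split_ifs <;> omega
      rw [if_neg (by omega), Finsupp.smul_single, hm]
      have e1 : merge (m + 1) i z.succ = (merge m i z).succ := by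
        apply Fin.ext
        simp only [merge_val, Fin.val_succ]
        split_ifs <;> omega
      have e2 : merge (m + 1) i ∘ insertSlot (m + 1) (z + 1) ∘ g =
          insertSlot m (z - 1 + 1) ∘ merge m i ∘ g := by
        funext x
        apply Fin.ext
        simp only [Function.comp_apply, merge_val, insertSlot_val]
        have := (g x).isLt
        split_ifs <;> omega
      rw [e1, e2, ← Finsupp.single_add]
      obtain ⟨l, hl⟩ : ∃ l, (z : ℕ) = l + 1 := ⟨z - 1, by omega⟩
      rw [hl, smul_eq_mul, Nat.add_sub_cancel, show (-1 : ℂ) ^ (l + 1) * (-1) ^ i +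
        (-1) ^ i * (-1) ^ l = 0 by ring, Finsupp.single_zero]
  have hhigh : ∑ i ∈ Finset.Ico ((z : ℕ) + 1) (m + 1 + 1),
      ((-1 : ℂ) ^ (z : ℕ) • Finsupp.single (Fin.cons (merge (m + 1) (i + 1) z.succ)
        (merge (m + 1) (i + 1) ∘ insertSlot (m + 1) (z + 1) ∘ g) : Fin (N + 1) → Fin (m + 2))
        ((-1 : ℂ) ^ (i + 1)) +
      if (merge m i z : ℕ) = 0 then 0 else
        Finsupp.single (Fin.cons (merge m i z).succ
          (insertSlot m (merge m i z + 1) ∘ merge m i ∘ g) : Fin (N + 1) → Fin (m + 2))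
          ((-1 : ℂ) ^ i * (-1 : ℂ) ^ (merge m i z : ℕ))) = 0 := by
    refine Finset.sum_eq_zero fun i hi => ?_
    rw [Finset.mem_Ico] at hi
    have hm : (merge m i z : ℕ) = z := by rw [merge_val]; split_ifs <;> omega
    rw [if_neg (by omega), Finsupp.smul_single, hm]
    have e1 : merge (m + 1) (i + 1) z.succ = (merge m i z).succ := by
      apply Fin.ext
      simp only [merge_val, Fin.val_succ]
      split_ifs <;> omega
    have e2 : merge (m + 1) (i + 1) ∘ insertSlot (m + 1) (z + 1) ∘ g =
        insertSlot m (z + 1) ∘ merge m i ∘ g := by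
      funext x
      apply Fin.ext
      simp only [Function.comp_apply, merge_val, insertSlot_val]
      have := (g x).isLt
      split_ifs <;> omega
    rw [e1, e2, ← Finsupp.single_add, smul_eq_mul, show (-1 : ℂ) ^ (z : ℕ) * (-1) ^ (i + 1) +
        (-1) ^ i * (-1) ^ (z : ℕ) = 0 by ring, Finsupp.single_zero]
  have hdiag : (-1 : ℂ) ^ (z : ℕ) • (Finsupp.single (Fin.cons (merge (m + 1) (z : ℕ) z.succ)
        (merge (m + 1) (z : ℕ) ∘ insertSlot (m + 1) (z + 1) ∘ g) : Fin (N + 1) → Fin (m + 2))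
        ((-1 : ℂ) ^ (z : ℕ))) = Finsupp.single (Fin.cons z g) 1 := by
    rw [Finsupp.smul_single, smul_eq_mul, ← pow_add, Even.neg_one_pow ⟨_, rfl⟩]
    congr 1
    congr 1
    · apply Fin.ext
      simp only [merge_val, Fin.val_succ]
      split_ifs <;> omega
    · funext x
      apply Fin.ext
      simp only [Function.comp_apply, merge_val, insertSlot_val]
      have := (g x).isLt
      split_ifs <;> omega
  rw [hlow, hhigh, hdiag]
  have hA : (-1 : ℂ) ^ (z : ℕ) • Finsupp.single (Fin.cons (merge (m + 1) (z + 1) z.succ)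
        (merge (m + 1) (z + 1) ∘ insertSlot (m + 1) (z + 1) ∘ g) : Fin (N + 1) → Fin (m + 2))
        ((-1 : ℂ) ^ ((z : ℕ) + 1)) ∈ firstFrom N (m + 1) (j + 1) := by
    refine Submodule.smul_mem _ _ (single_mem_firstFrom ?_)
    rw [Fin.cons_zero, merge_val, Fin.val_succ]
    split_ifs <;> omega
  have hB : (if (merge m z z : ℕ) = 0 then (0 : SlotChain (Fin (N + 1)) (m + 1)) else
        Finsupp.single (Fin.cons (merge m z z).succ
          (insertSlot m (merge m z z + 1) ∘ merge m z ∘ g) : Fin (N + 1) → Fin (m + 2))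
          ((-1 : ℂ) ^ (z : ℕ) * (-1 : ℂ) ^ (merge m z z : ℕ))) ∈ firstFrom N (m + 1) (j + 1) := by
    split_ifs with h
    · exact Submodule.zero_mem _
    · refine single_mem_firstFrom ?_
      rw [merge_val] at h
      rw [Fin.cons_zero, Fin.val_succ, merge_val]
      split_ifs at h ⊢ <;> omega
  convert Submodule.add_mem _ hA hB using 1
  abel

/-- The inclusion of the distributions with the element `0` in slot `0`. -/
noncomputable def addFirst (N m : ℕ) :
    SlotChain (Fin N) m →ₗ[ℂ] SlotChain (Fin (N + 1)) m :=
  Finsupp.lmapDomain ℂ ℂ fun g => Fin.cons 0 g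

/-- Forgetting the element `0`. -/
noncomputable def forgetFirst (N m : ℕ) :
    SlotChain (Fin (N + 1)) m →ₗ[ℂ] SlotChain (Fin N) m :=
  Finsupp.lmapDomain ℂ ℂ fun f => Fin.tail f

theorem merge_comp_cons_zero (m i : ℕ) (g : Fin N → Fin (m + 2)) :
    merge m i ∘ (Fin.cons 0 g : Fin (N + 1) → Fin (m + 2)) = Fin.cons 0 (merge m i ∘ g) := by
  funext x
  cases x using Fin.cases
  · apply Fin.ext
    simp [merge_val]
  · rfl

theorem slotBoundary_addFirst (m : ℕ) (c : SlotChain (Fin N) (m + 1)) :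
    slotBoundary _ m (addFirst N (m + 1) c) = addFirst N m (slotBoundary _ m c) := by
  suffices h : slotBoundary _ m ∘ₗ addFirst N (m + 1) = addFirst N m ∘ₗ slotBoundary _ m from
    LinearMap.congr_fun h c
  refine SlotChain.hom_ext fun g => ?_
  simp only [LinearMap.comp_apply, slotBoundary_single, addFirst, Finsupp.lmapDomain_apply,
    Finsupp.mapDomain_single, map_sum, merge_comp_cons_zero]

theorem slotBoundary_forgetFirst (m : ℕ) (c : SlotChain (Fin (N + 1)) (m + 1)) :
    slotBoundary _ m (forgetFirst N (m + 1) c) = forgetFirst N m (slotBoundary _ m c) := by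
  suffices h : slotBoundary _ m ∘ₗ forgetFirst N (m + 1) =
      forgetFirst N m ∘ₗ slotBoundary _ m from LinearMap.congr_fun h c
  refine SlotChain.hom_ext fun g => ?_
  simp only [LinearMap.comp_apply, slotBoundary_single, forgetFirst, Finsupp.lmapDomain_apply,
    Finsupp.mapDomain_single, map_sum]
  rfl

/-- There are no slots from `j` on when `m < j`, so the element `0` can only be in slot `0`. -/
theorem addFirst_forgetFirst {m j : ℕ} (hj : m < j) {c : SlotChain (Fin (N + 1)) m}
    (hc : c ∈ firstFrom N m j) : addFirst N m (forgetFirst N m c) = c := by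
  have : firstFrom N m j ≤
      LinearMap.eqLocus (addFirst N m ∘ₗ forgetFirst N m) LinearMap.id := by
    rw [firstFrom, Finsupp.supported_eq_span_single, Submodule.span_le]
    rintro _ ⟨f, hf, rfl⟩
    simp only [Set.mem_ofPred_eq] at hf
    have hf0 : f 0 = 0 := Fin.ext (by have := (f 0).isLt; simp only [Fin.val_zero]; omega)
    simp only [SetLike.mem_coe, LinearMap.mem_eqLocus, LinearMap.comp_apply, addFirst,
      forgetFirst, Finsupp.lmapDomain_apply, Finsupp.mapDomain_single, LinearMap.id_apply]
    rw [← hf0, Fin.cons_self_tail]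
  exact this hc

theorem placing_forgetFirst {m : ℕ} (e : Fin m → Fin N) (c : SlotChain (Fin (N + 1)) m) :
    placing e (forgetFirst N m c) = placing (Fin.succ ∘ e) c := by
  classical
  suffices h : placing e ∘ₗ forgetFirst N m = placing (Fin.succ ∘ e) from LinearMap.congr_fun h c
  refine SlotChain.hom_ext fun g => ?_
  simp only [LinearMap.comp_apply, forgetFirst, Finsupp.lmapDomain_apply,
    Finsupp.mapDomain_single, placing_single]
  rfl

/-- The cap product is adjoint to the cup product: capping with the first circle prepends the
element `0` to `e`. -/
theorem placing_removeFirst {m : ℕ} (e : Fin m → Fin N) (c : SlotChain (Fin (N + 1)) (m + 1)) :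
    placing e (removeFirst N m c) =
      placing (Fin.cons 0 (Fin.succ ∘ e) : Fin (m + 1) → Fin (N + 1)) c := by
  classical
  suffices h : placing e ∘ₗ removeFirst N m = placing (Fin.cons 0 (Fin.succ ∘ e)) from
    LinearMap.congr_fun h c
  refine SlotChain.hom_ext fun f => ?_
  simp only [LinearMap.comp_apply, removeFirst, Finsupp.linearCombination_single, one_smul,
    placing_single, Fin.forall_fin_succ (n := m), Fin.cons_zero, Fin.cons_succ]
  by_cases h1 : (f 0 : ℕ) = 1
  · rw [if_pos h1, placing_single]
    refine if_congr ?_ rfl rfl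
    have h1' : f 0 = Fin.succ 0 := Fin.ext (by simpa using h1)
    simp only [h1', true_and, Fin.ext_iff, Function.comp_apply, merge_val, Fin.val_succ, Fin.tail]
    refine forall_congr' fun a => ?_
    split_ifs <;> omega
  · rw [if_neg h1, map_zero, if_neg]
    rintro ⟨h, -⟩
    exact h1 (by simp [h])

/-- A cycle killed by `removeFirst` can be moved until the element `0` avoids the slots
`1, …, j - 1`. -/
theorem exists_sub_mem_firstFrom {m j : ℕ} (hj : 1 ≤ j) {c : SlotChain (Fin (N + 1)) (m + 1)}
    (hc : slotBoundary _ m c = 0) (hp : removeFirst N m c = 0) :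
    ∃ w, c - slotBoundary _ (m + 1) w ∈ firstFrom N (m + 1) j ∧
      removeFirst N m (c - slotBoundary _ (m + 1) w) = 0 := by
  induction j, hj using Nat.le_induction with
  | base =>
    refine ⟨0, ?_, by simpa using hp⟩
    rw [firstFrom, Set.eq_univ_of_forall (s := {f : Fin (N + 1) → Fin (m + 1 + 1) |
      (f 0 : ℕ) = 0 ∨ 1 ≤ (f 0 : ℕ)}) fun f => by simp only [Set.mem_ofPred_eq]; omega,
      Finsupp.supported_univ]
    trivial
  | succ j hj ih =>
    obtain ⟨w, hw, hpw⟩ := ih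
    set c' := c - slotBoundary _ (m + 1) w with hc'
    have hcyc : slotBoundary _ m c' = 0 := by
      rw [hc', map_sub, hc, slotBoundary_slotBoundary, sub_zero]
    have h := moveFirst_homotopy hw
    rw [hcyc, map_zero, add_zero, hpw, map_zero, add_zero] at h
    have h' : c - slotBoundary _ (m + 1) (w + moveFirst N (m + 1) c') ∈
        firstFrom N (m + 1) (j + 1) := by
      rw [map_add, ← sub_sub, ← hc', ← neg_sub]
      exact Submodule.neg_mem _ h
    -- From `j + 1 ≥ 2` on, slot `1` is avoided, so `removeFirst` stays zero and the induction
    -- continues.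
    exact ⟨_, h', removeFirst_eq_zero (by omega) h'⟩

end Torus

/-- The cycles of the complex of distributions; in degree `0` every chain is a cycle. -/
noncomputable def slotCycles (ι : Type*) : (m : ℕ) → Submodule ℂ (SlotChain ι m)
  | 0 => ⊤
  | m + 1 => LinearMap.ker (slotBoundary ι m)

theorem slotBoundary_mem_slotCycles {ι : Type*} (m : ℕ) (c : SlotChain ι (m + 1)) :
    slotBoundary ι m c ∈ slotCycles ι m := by
  cases m with
  | zero => trivial
  | succ m => exact slotBoundary_slotBoundary m c

theorem eq_zero_of_placing_eq_zero {ι : Type*} (c : SlotChain ι 0) (e : Fin 0 → ι)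
    (h : placing e c = 0) : c = 0 := by
  classical
  have hsub : ∀ f : ι → Fin (0 + 1), f = fun _ => 0 := fun f => funext fun x =>
    Fin.ext (Nat.lt_one_iff.1 (f x).isLt)
  have hs : c = Finsupp.single (fun _ => 0) (c fun _ => 0) := by
    ext f
    rw [hsub f, Finsupp.single_eq_same]
  rw [hs] at h ⊢
  rw [placing_single, if_pos (fun a => a.elim0)] at h
  rw [h, Finsupp.single_zero]

/-- The homology of the complex of distributions is detected by the counts along increasing
families. -/
theorem exists_slotBoundary_eq (N m : ℕ) (c : SlotChain (Fin N) m)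
    (hc : c ∈ slotCycles (Fin N) m)
    (hφ : ∀ e : Fin m → Fin N, StrictMono e → placing e c = 0) :
    ∃ y, slotBoundary _ m y = c := by
  induction N generalizing m with
  | zero =>
    cases m with
    | zero =>
      exact ⟨0, by rw [map_zero, eq_zero_of_placing_eq_zero c Fin.elim0 (hφ _ fun a => a.elim0)]⟩
    | succ m =>
      -- Without elements the complex is that of a point: `ℂ` in every degree, with differentials
      -- alternately `0` and `1`.
      let d : (l : ℕ) → Fin 0 → Fin (l + 1) := fun _ => Fin.elim0
      have hb : ∀ (l : ℕ) (r : ℂ), slotBoundary (Fin 0) l (Finsupp.single (d (l + 1)) r) =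
          Finsupp.single (d l) (r * ∑ i ∈ Finset.range (l + 2), (-1 : ℂ) ^ i) := by
        intro l r
        have h1 : slotBoundary (Fin 0) l (Finsupp.single (d (l + 1)) 1) =
            Finsupp.single (d l) (∑ i ∈ Finset.range (l + 2), (-1 : ℂ) ^ i) := by
          rw [slotBoundary_single, ← Finsupp.lsingle_apply (R := ℂ) (d l), map_sum]
          exact Finset.sum_congr rfl fun i _ => by
            rw [Finsupp.lsingle_apply]; congr 1; exact Subsingleton.elim _ _
        rw [← mul_one r, ← smul_eq_mul r 1, ← Finsupp.smul_single, map_smul, h1,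
          Finsupp.smul_single, smul_eq_mul, smul_eq_mul, mul_one]
      have hs : c = Finsupp.single (d (m + 1)) (c (d (m + 1))) := by
        refine Finsupp.ext fun f => ?_
        rw [Subsingleton.elim f (d (m + 1)), Finsupp.single_eq_same]
      have hc0 : slotBoundary (Fin 0) m c = 0 := hc
      rw [hs, hb, neg_one_geom_sum] at hc0
      rcases Nat.even_or_odd m with hm | hm
      · refine ⟨Finsupp.single (d (m + 2)) (c (d (m + 1))), ?_⟩
        rw [hb, neg_one_geom_sum, if_neg (by grind), mul_one, ← hs]
      · rw [if_neg (by grind), mul_one, Finsupp.single_eq_zero] at hc0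
        exact ⟨0, by rw [map_zero, hs, hc0, Finsupp.single_zero]⟩
  | succ N ih =>
    cases m with
    | zero =>
      exact ⟨0, by rw [map_zero, eq_zero_of_placing_eq_zero c _ (hφ Fin.elim0 fun a => a.elim0)]⟩
    | succ m =>
      have hc0 : slotBoundary _ m c = 0 := hc
      -- The homology of a product with a circle has two summands. This is the one that involves the
      -- new circle: its counts are those of `c` along families beginning with `0`, hence it bounds.
      obtain ⟨y, hy⟩ : ∃ y, slotBoundary _ m y = removeFirst N m c := by
        refine ih m _ ?_ fun e he => ?_
        · cases m with
          | zero => trivial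
          | succ m =>
            change slotBoundary _ m (removeFirst N (m + 1) c) = 0
            rw [← neg_eq_zero, ← removeFirst_slotBoundary, hc0, map_zero]
        · rw [placing_removeFirst]
          refine hφ _ ?_
          intro a b hab
          cases b using Fin.cases with
          | zero => exact absurd hab (Fin.not_lt_zero a)
          | succ b =>
            cases a using Fin.cases with
            | zero => simp
            | succ a => simpa using he (by simpa using hab)
      set c₁ := c + slotBoundary _ (m + 1) (insertFirst N (m + 1) y) with hc₁
      have hcyc : slotBoundary _ m c₁ = 0 := by
        rw [hc₁, map_add, hc0, slotBoundary_slotBoundary, add_zero]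
      have hp : removeFirst N m c₁ = 0 := by
        rw [hc₁, map_add, removeFirst_slotBoundary, removeFirst_insertFirst, hy, add_neg_cancel]
      -- The bound `m + 2` exceeds all slots, so the element `0` ends up in slot `0` and what
      -- remains is a cycle of the smaller torus.
      obtain ⟨w, hw, -⟩ := exists_sub_mem_firstFrom (show 1 ≤ m + 2 by omega) hcyc hp
      have hadd := addFirst_forgetFirst (by omega) hw
      obtain ⟨y₃, hy₃⟩ := ih (m + 1) (forgetFirst N (m + 1) (c₁ - slotBoundary _ (m + 1) w)) (by
          change slotBoundary _ m _ = 0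
          rw [slotBoundary_forgetFirst, map_sub, hcyc, slotBoundary_slotBoundary, sub_zero,
            map_zero]) (fun e he => by
          rw [placing_forgetFirst, map_sub, hc₁, map_add, placing_slotBoundary,
            placing_slotBoundary, add_zero, sub_zero]
          exact hφ _ fun a b hab => Fin.succ_lt_succ_iff.2 (he hab))
      refine ⟨addFirst N (m + 2) y₃ + w - insertFirst N (m + 1) y, ?_⟩
      rw [map_sub, map_add, slotBoundary_addFirst, hy₃, hadd, hc₁]
      abel

/-! ### Degenerate distributions -/

section Degenerate

variable {ι : Type*}

theorem exists_empty_slot {m : ℕ} (g : ι → Fin (m + 1)) : ∃ j, 1 ≤ j ∧ ∀ x, (g x : ℕ) ≠ j :=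
  ⟨m + 1, by omega, fun x => (g x).isLt.ne⟩

open Classical in
/-- The first empty slot other than slot `0`; it is `m + 1` if there is none. -/
noncomputable def firstEmpty {m : ℕ} (g : ι → Fin (m + 1)) : ℕ := Nat.find (exists_empty_slot g)

theorem firstEmpty_eq_iff {m j : ℕ} (g : ι → Fin (m + 1)) :
    firstEmpty g = j ↔
      (1 ≤ j ∧ ∀ x, (g x : ℕ) ≠ j) ∧ ∀ i, 1 ≤ i → i < j → ∃ x, (g x : ℕ) = i := by
  classical
  rw [firstEmpty, Nat.find_eq_iff]
  refine and_congr_right fun _ => forall_congr' fun i => ?_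
  push Not
  exact ⟨fun h h1 h2 => h h2 h1, fun h h2 h1 => h h1 h2⟩

/-- A distribution is degenerate if a slot other than slot `0` is empty. -/
def Degenerate {m : ℕ} (g : ι → Fin (m + 1)) : Prop := ∃ j : Fin (m + 1), j ≠ 0 ∧ ∀ x, g x ≠ j

theorem degenerate_iff {m : ℕ} (g : ι → Fin (m + 1)) : Degenerate g ↔ firstEmpty g ≤ m := by
  obtain ⟨⟨h1, h2⟩, h3⟩ := (firstEmpty_eq_iff g).1 rfl
  constructor
  · rintro ⟨j, hj, h⟩
    by_contra hlt
    obtain ⟨x, hx⟩ := h3 j (by rw [Nat.one_le_iff_ne_zero]; exact fun h => hj (Fin.ext h))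
      (by have := j.isLt; omega)
    exact h x (Fin.ext hx)
  · intro h
    refine ⟨⟨firstEmpty g, by omega⟩, fun h0 => ?_, fun x hx => h2 x (Fin.ext_iff.1 hx)⟩
    have := Fin.ext_iff.1 h0
    simp only [Fin.val_zero] at this
    omega

/-- Doubling the first empty slot. -/
noncomputable def doubleEmpty (ι : Type*) (m : ℕ) : SlotChain ι m →ₗ[ℂ] SlotChain ι (m + 1) :=
  Finsupp.linearCombination ℂ fun g =>
    Finsupp.single (insertSlot m (firstEmpty g) ∘ g) ((-1 : ℂ) ^ firstEmpty g)

theorem doubleEmpty_single {m : ℕ} (g : ι → Fin (m + 1)) (r : ℂ) :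
    doubleEmpty ι m (Finsupp.single g r) =
      Finsupp.single (insertSlot m (firstEmpty g) ∘ g) (r * (-1 : ℂ) ^ firstEmpty g) := by
  simp [doubleEmpty]

/-- Let `j` be the first empty slot. Faces `j - 1`, `j`, `j + 1` of the doubled distribution all
return `f`, with total coefficient `-1`. Faces `j - 1` and `j` of `f` coincide and cancel. The other
faces cancel in pairs, because merging below `j - 1` moves the first empty slot to `j - 1` and
merging above `j` leaves it at `j`. -/
theorem doubleEmpty_homotopy {m : ℕ} {f : ι → Fin (m + 2)} (hf : Degenerate f) :
    slotBoundary ι (m + 1) (doubleEmpty ι (m + 1) (Finsupp.single f 1)) +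
      doubleEmpty ι m (slotBoundary ι m (Finsupp.single f 1)) = -Finsupp.single f 1 := by
  rw [degenerate_iff] at hf
  obtain ⟨⟨h1, h2⟩, h3⟩ := (firstEmpty_eq_iff f).1 rfl
  set j := firstEmpty f with hj
  have hlt : ∀ x, (f x : ℕ) < m + 2 := fun x => (f x).isLt
  have hs : doubleEmpty ι (m + 1) (Finsupp.single f 1) =
      (-1 : ℂ) ^ j • Finsupp.single (insertSlot (m + 1) j ∘ f) 1 := by
    rw [doubleEmpty_single, one_mul, Finsupp.smul_single, smul_eq_mul, mul_one]
  rw [hs, map_smul, slotBoundary_single, Finset.smul_sum, slotBoundary_single, map_sum]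
  simp only [doubleEmpty_single, Finsupp.smul_single, smul_eq_mul]
  rw [sum_range_add_sum_range (j := j) _ _ hf]
  obtain ⟨l, hl⟩ : ∃ l, j = l + 1 := ⟨j - 1, by omega⟩
  have hhigh : ∑ i ∈ Finset.Ico (j + 1) (m + 1 + 1),
      (Finsupp.single (merge (m + 1) (i + 1) ∘ insertSlot (m + 1) j ∘ f)
          ((-1 : ℂ) ^ j * (-1) ^ (i + 1)) +
        Finsupp.single (insertSlot m (firstEmpty (merge m i ∘ f)) ∘ merge m i ∘ f)
          ((-1 : ℂ) ^ i * (-1) ^ firstEmpty (merge m i ∘ f))) = 0 := by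
    refine Finset.sum_eq_zero fun i hi => ?_
    rw [Finset.mem_Ico] at hi
    have hfe : firstEmpty (merge m i ∘ f) = j := by
      rw [firstEmpty_eq_iff]
      refine ⟨⟨h1, fun x => ?_⟩, fun a ha1 ha2 => ?_⟩
      · have := h2 x
        simp only [Function.comp_apply, merge_val]
        split_ifs <;> omega
      · obtain ⟨x, hx⟩ := h3 a ha1 ha2
        refine ⟨x, ?_⟩
        simp only [Function.comp_apply, merge_val]
        split_ifs <;> omega
    rw [hfe]
    have e : merge (m + 1) (i + 1) ∘ insertSlot (m + 1) j ∘ f = insertSlot m j ∘ merge m i ∘ f := by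
      funext x
      apply Fin.ext
      have := h2 x
      have := hlt x
      simp only [Function.comp_apply, merge_val, insertSlot_val]
      split_ifs <;> omega
    rw [e, ← Finsupp.single_add, show (-1 : ℂ) ^ j * (-1) ^ (i + 1) + (-1) ^ i * (-1) ^ j = 0 by
      ring, Finsupp.single_zero]
  have hlow : ∑ i ∈ Finset.range l,
      (Finsupp.single (merge (m + 1) i ∘ insertSlot (m + 1) j ∘ f)
          ((-1 : ℂ) ^ j * (-1) ^ i) +
        Finsupp.single (insertSlot m (firstEmpty (merge m i ∘ f)) ∘ merge m i ∘ f)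
          ((-1 : ℂ) ^ i * (-1) ^ firstEmpty (merge m i ∘ f))) = 0 := by
    refine Finset.sum_eq_zero fun i hi => ?_
    rw [Finset.mem_range] at hi
    have hfe : firstEmpty (merge m i ∘ f) = l := by
      rw [firstEmpty_eq_iff]
      refine ⟨⟨by omega, fun x => ?_⟩, fun a ha1 ha2 => ?_⟩
      · have := h2 x
        simp only [Function.comp_apply, merge_val]
        split_ifs <;> omega
      · obtain ⟨x, hx⟩ := h3 (if a ≤ i then a else a + 1) (by split_ifs <;> omega)
          (by split_ifs <;> omega)
        refine ⟨x, ?_⟩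
        simp only [Function.comp_apply, merge_val]
        split_ifs at * <;> omega
    rw [hfe]
    have e : merge (m + 1) i ∘ insertSlot (m + 1) j ∘ f = insertSlot m l ∘ merge m i ∘ f := by
      funext x
      apply Fin.ext
      have := h2 x
      have := hlt x
      simp only [Function.comp_apply, merge_val, insertSlot_val]
      split_ifs <;> omega
    rw [e, hl, ← Finsupp.single_add, show (-1 : ℂ) ^ (l + 1) * (-1) ^ i + (-1) ^ i * (-1) ^ l = 0 by
      ring, Finsupp.single_zero]
  have hmid : ∀ i, j - 1 ≤ i → i ≤ j + 1 → merge (m + 1) i ∘ insertSlot (m + 1) j ∘ f = f := by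
    intro i hi1 hi2
    funext x
    apply Fin.ext
    have := h2 x
    have := hlt x
    simp only [Function.comp_apply, merge_val, insertSlot_val]
    split_ifs <;> omega
  have hB : merge m l ∘ f = merge m j ∘ f := by
    funext x
    apply Fin.ext
    have := h2 x
    have := hlt x
    simp only [Function.comp_apply, merge_val]
    split_ifs <;> omega
  rw [hhigh, add_zero, hl, Finset.sum_range_succ, ← hl, hlow, zero_add, hmid l (by omega) (by omega),
    hmid j (by omega) (by omega), hmid (j + 1) (by omega) (by omega), hB]
  have e1 : (Finsupp.single f ((-1 : ℂ) ^ j * (-1) ^ l)) = -Finsupp.single f 1 := by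
    rw [hl, ← Finsupp.single_neg]
    congr 1
    rw [pow_succ, mul_neg_one, neg_mul, ← pow_add, Even.neg_one_pow ⟨l, rfl⟩]
  have e2 : (Finsupp.single f ((-1 : ℂ) ^ j * (-1) ^ j)) = Finsupp.single f 1 := by
    rw [← pow_add, Even.neg_one_pow ⟨j, rfl⟩]
  have e3 : (Finsupp.single f ((-1 : ℂ) ^ j * (-1) ^ (j + 1))) = -Finsupp.single f 1 := by
    rw [← Finsupp.single_neg]
    congr 1
    rw [pow_succ, mul_neg_one, mul_neg, ← pow_add, Even.neg_one_pow ⟨j, rfl⟩]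
  have e4 : ∀ (h : ι → Fin (m + 2)) (a : ℂ),
      Finsupp.single h ((-1 : ℂ) ^ l * a) = -Finsupp.single h ((-1) ^ j * a) := by
    intro h a
    rw [hl, ← Finsupp.single_neg]
    congr 1
    ring
  rw [e1, e2, e3, e4]
  abel

/-- The complex of degenerate distributions in a class closed under insertion of empty slots is
acyclic. -/
theorem exists_slotBoundary_eq_of_degenerate (P : (m : ℕ) → (ι → Fin (m + 1)) → Prop)
    (hP : ∀ m j (g : ι → Fin (m + 1)), 1 ≤ j → P m g → P (m + 1) (insertSlot m j ∘ g))
    (m : ℕ) {c : SlotChain ι m} (hc : c ∈ Finsupp.supported ℂ ℂ {g | Degenerate g ∧ P m g})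
    (hcyc : c ∈ slotCycles ι m) :
    ∃ y ∈ Finsupp.supported ℂ ℂ {g | P (m + 1) g}, slotBoundary ι m y = c := by
  cases m with
  | zero =>
    refine ⟨0, Submodule.zero_mem _, ?_⟩
    rw [map_zero]
    have h0 : {g : ι → Fin (0 + 1) | Degenerate g ∧ P 0 g} = ∅ := by
      refine Set.eq_empty_of_forall_notMem fun g hg => ?_
      obtain ⟨j, hj, -⟩ := hg.1
      exact hj (Fin.ext (Nat.lt_one_iff.1 j.isLt))
    rw [h0, Finsupp.supported_empty, Submodule.mem_bot] at hc
    exact hc.symm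
  | succ m =>
    have key : ∀ c ∈ Finsupp.supported ℂ ℂ {g : ι → Fin (m + 2) | Degenerate g ∧ P (m + 1) g},
        slotBoundary ι (m + 1) (doubleEmpty ι (m + 1) c) + doubleEmpty ι m (slotBoundary ι m c) =
          -c ∧ doubleEmpty ι (m + 1) c ∈ Finsupp.supported ℂ ℂ {g | P (m + 2) g} := by
      have : Finsupp.supported ℂ ℂ {g : ι → Fin (m + 2) | Degenerate g ∧ P (m + 1) g} ≤
          LinearMap.eqLocus (slotBoundary ι (m + 1) ∘ₗ doubleEmpty ι (m + 1) +
            doubleEmpty ι m ∘ₗ slotBoundary ι m) (-LinearMap.id) ⊓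
          (Finsupp.supported ℂ ℂ {g | P (m + 2) g}).comap (doubleEmpty ι (m + 1)) := by
        rw [Finsupp.supported_eq_span_single, Submodule.span_le]
        rintro _ ⟨f, ⟨hf, hPf⟩, rfl⟩
        refine ⟨doubleEmpty_homotopy hf, ?_⟩
        rw [SetLike.mem_coe, Submodule.mem_comap, doubleEmpty_single]
        exact Finsupp.single_mem_supported ℂ _ (hP _ _ _ ((firstEmpty_eq_iff f).1 rfl).1.1 hPf)
      exact fun c hc => this hc
    obtain ⟨h1, h2⟩ := key c hc
    have hcyc0 : slotBoundary ι m c = 0 := hcyc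
    refine ⟨-doubleEmpty ι (m + 1) c, Submodule.neg_mem _ h2, ?_⟩
    rw [hcyc0, map_zero, add_zero] at h1
    rw [map_neg, h1, neg_neg]

/-- The two faces that merge the empty slot `j` with a neighbour agree and have opposite signs;
every other face still has an empty slot. -/
theorem slotBoundary_mem_degenerate {m : ℕ} {c : SlotChain ι (m + 1)}
    (hc : c ∈ Finsupp.supported ℂ ℂ {g | Degenerate g}) :
    slotBoundary ι m c ∈ Finsupp.supported ℂ ℂ {g | Degenerate g} := by
  suffices h : Finsupp.supported ℂ ℂ {g : ι → Fin (m + 2) | Degenerate g} ≤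
      (Finsupp.supported ℂ ℂ {g | Degenerate g}).comap (slotBoundary ι m) from h hc
  conv_lhs => rw [Finsupp.supported_eq_span_single]
  rw [Submodule.span_le]
  rintro _ ⟨f, ⟨j, hj0, hj⟩, rfl⟩
  have hlt : ∀ x, (f x : ℕ) < m + 2 := fun x => (f x).isLt
  have hj' : ∀ x, (f x : ℕ) ≠ j := fun x hx => hj x (Fin.ext hx)
  obtain ⟨l, hl⟩ : ∃ l, (j : ℕ) = l + 1 :=
    ⟨j - 1, by have : (j : ℕ) ≠ 0 := fun h => hj0 (Fin.ext h); omega⟩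
  have hjlt := j.isLt
  rw [SetLike.mem_coe, Submodule.mem_comap, slotBoundary_single,
    ← Finset.sum_sdiff (s₁ := {l, l + 1}) (by
      intro i hi
      simp only [Finset.mem_insert, Finset.mem_singleton, Finset.mem_range] at hi ⊢
      omega),
    Finset.sum_pair (by omega)]
  have e : merge m l ∘ f = merge m (l + 1) ∘ f := by
    funext x
    apply Fin.ext
    have := hj' x
    have := hlt x
    simp only [Function.comp_apply, merge_val]
    split_ifs <;> omega
  rw [e, ← Finsupp.single_add, show (-1 : ℂ) ^ l + (-1) ^ (l + 1) = 0 by ring, Finsupp.single_zero,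
    add_zero]
  refine Submodule.sum_mem _ fun i hi => Finsupp.single_mem_supported ℂ _ ?_
  simp only [Finset.mem_sdiff, Finset.mem_insert, Finset.mem_singleton, Finset.mem_range] at hi
  refine ⟨⟨if i < l then l else l + 1, by split_ifs <;> omega⟩, fun h => ?_, fun x h => ?_⟩
  · have h1 := Fin.ext_iff.1 h
    dsimp only [Fin.val_zero] at h1
    split_ifs at h1
    omega
  · have h1 := Fin.ext_iff.1 h
    dsimp only [Function.comp_apply] at h1
    rw [merge_val] at h1
    have := hj' x
    have := hlt x
    split_ifs at h1 <;> omega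

/-- The cocycle is normalized: a distribution that it counts occupies every slot other than `0`. -/
theorem placing_eq_zero_of_degenerate {m : ℕ} {c : SlotChain ι m}
    (hc : c ∈ Finsupp.supported ℂ ℂ {g | Degenerate g}) (e : Fin m → ι) : placing e c = 0 := by
  classical
  suffices h : Finsupp.supported ℂ ℂ {g : ι → Fin (m + 1) | Degenerate g} ≤
      LinearMap.ker (placing e) from h hc
  rw [Finsupp.supported_eq_span_single, Submodule.span_le]
  rintro _ ⟨f, ⟨j, hj0, hj⟩, rfl⟩
  rw [SetLike.mem_coe, LinearMap.mem_ker, placing_single, if_neg]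
  intro h
  obtain ⟨a, rfl⟩ := Fin.exists_succ_eq.2 hj0
  exact hj _ (h a)

end Degenerate

/-! ### The fundamental cycles -/

/-- The distribution with `e a` in slot `σ a + 1`, everything else in slot `0`. -/
noncomputable def spread {ι : Type*} {m : ℕ} (e : Fin m → ι) (σ : Equiv.Perm (Fin m)) :
    ι → Fin (m + 1) :=
  Function.extend e (fun a => (σ a).succ) fun _ => 0

/-- The antisymmetrization of the distribution with `e a` in slot `a + 1`, everything else in
slot `0`. -/
noncomputable def antisym {ι : Type*} {m : ℕ} (e : Fin m → ι) : SlotChain ι m :=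
  ∑ σ : Equiv.Perm (Fin m), ((Equiv.Perm.sign σ : ℤ) : ℂ) • Finsupp.single (spread e σ) 1

/-- This is the shuffle product of the fundamental cycles of circles. An inner face merges two slots
and is unchanged when they are transposed, so antisymmetrization kills it. The two outer faces
differ by a cyclic permutation of sign `(-1)^m` and cancel each other. -/
theorem antisym_mem_slotCycles {ι : Type*} {m : ℕ} {e : Fin m → ι} (he : Function.Injective e) :
    antisym e ∈ slotCycles ι m := by
  cases m with
  | zero => trivial
  | succ m =>
    change slotBoundary ι m (antisym e) = 0
    let Ω : ℕ → SlotChain ι m := fun i => ∑ σ : Equiv.Perm (Fin (m + 1)),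
      ((Equiv.Perm.sign σ : ℤ) : ℂ) • Finsupp.single
        (Function.extend e (fun a => merge m i (σ a).succ) fun _ => 0) 1
    have hcomp : ∀ (i : ℕ) (σ : Equiv.Perm (Fin (m + 1))), merge m i ∘ spread e σ =
        Function.extend e (fun a => merge m i (σ a).succ) fun _ => 0 := by
      intro i σ
      funext x
      by_cases hx : ∃ a, e a = x
      · obtain ⟨a, rfl⟩ := hx
        rw [Function.comp_apply, spread, he.extend_apply, he.extend_apply]
      · rw [Function.comp_apply, spread, Function.extend_apply' _ _ _ hx,
          Function.extend_apply' _ _ _ hx]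
        apply Fin.ext
        simp [merge_val]
    have hsum : slotBoundary ι m (antisym e) =
        ∑ i ∈ Finset.range (m + 2), (-1 : ℂ) ^ i • Ω i := by
      simp only [antisym, map_sum, map_smul, slotBoundary_single, Finset.smul_sum, Ω, hcomp]
      rw [Finset.sum_comm]
      refine Finset.sum_congr rfl fun i _ => Finset.sum_congr rfl fun σ _ => ?_
      simp [mul_comm]
    have hshift : ∀ (τ : Equiv.Perm (Fin (m + 1))) (i i' : ℕ),
        (∀ b : Fin (m + 1), merge m i' b.succ = merge m i (τ b).succ) →
        Ω i' = ((Equiv.Perm.sign τ : ℤ) : ℂ) • Ω i := by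
      intro τ i i' h
      simp only [Ω]
      rw [← Equiv.sum_comp (Equiv.mulLeft τ) (fun σ : Equiv.Perm (Fin (m + 1)) =>
        ((Equiv.Perm.sign σ : ℤ) : ℂ) • (Finsupp.single
        (Function.extend e (fun a => merge m i (σ a).succ) fun _ => 0) 1 : SlotChain ι m)),
        Finset.smul_sum]
      refine Finset.sum_congr rfl fun σ _ => ?_
      simp only [Equiv.coe_mulLeft, Equiv.Perm.mul_apply, map_mul, smul_smul, h]
      congr 1
      push_cast
      rw [← mul_assoc, ← Int.cast_mul, Int.units_coe_mul_self, Int.cast_one, one_mul]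
    have hzero : ∀ i, i < m → Ω (i + 1) = 0 := by
      intro i hi
      have h := hshift (Equiv.swap ⟨i, by omega⟩ ⟨i + 1, by omega⟩) (i + 1) (i + 1) (by
        intro b
        rcases eq_or_ne b ⟨i, by omega⟩ with rfl | h1
        · rw [Equiv.swap_apply_left]
          apply Fin.ext
          simp only [merge_val, Fin.val_succ]
          split_ifs <;> omega
        rcases eq_or_ne b ⟨i + 1, by omega⟩ with rfl | h2
        · rw [Equiv.swap_apply_right]
          apply Fin.ext
          simp only [merge_val, Fin.val_succ]
          split_ifs <;> omega
        · rw [Equiv.swap_apply_of_ne_of_ne h1 h2])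
      rw [Equiv.Perm.sign_swap (by simp)] at h
      simp only [Units.val_neg, Units.val_one, Int.cast_neg, Int.cast_one, neg_smul, one_smul] at h
      exact self_eq_neg.1 h
    have hlast : Ω (m + 1) = (-1 : ℂ) ^ m • Ω 0 := by
      rw [hshift (finRotate (m + 1)) 0 (m + 1), sign_finRotate]
      · simp
      · intro b
        apply Fin.ext
        rw [finRotate_apply, merge_val, merge_val, Fin.val_succ, Fin.val_succ, Fin.val_add_one]
        have := b.isLt
        simp only [Fin.ext_iff, Fin.val_last]
        split_ifs <;> omega
    rw [hsum, Finset.sum_range_succ', Finset.sum_range_succ, Finset.sum_eq_zero, hlast, zero_add,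
      smul_smul, ← pow_add, pow_zero, Odd.neg_one_pow ⟨m, by ring⟩, neg_one_smul, one_smul,
      neg_add_cancel]
    intro i hi
    rw [hzero i (Finset.mem_range.1 hi), smul_zero]

theorem spread_apply {ι : Type*} {m : ℕ} {e : Fin m → ι} (he : Function.Injective e)
    (σ : Equiv.Perm (Fin m)) (a : Fin m) : spread e σ (e a) = (σ a).succ :=
  he.extend_apply _ _ a

theorem spread_eq_zero_iff {ι : Type*} {m : ℕ} {e : Fin m → ι} (he : Function.Injective e)
    (σ : Equiv.Perm (Fin m)) (x : ι) : spread e σ x = 0 ↔ x ∉ Set.range e := by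
  constructor
  · rintro h ⟨a, rfl⟩
    rw [spread_apply he] at h
    exact Fin.succ_ne_zero _ h
  · exact fun h => Function.extend_apply' _ _ _ h

theorem spread_eq_spread {N m : ℕ} {e e' : Fin m → Fin N} (he : StrictMono e)
    (he' : StrictMono e') {σ σ' : Equiv.Perm (Fin m)} (h : spread e σ = spread e' σ') :
    e = e' ∧ σ = σ' := by
  have hr : Set.range e = Set.range e' := by
    ext x
    rw [← not_iff_not, ← spread_eq_zero_iff he.injective σ, h, spread_eq_zero_iff he'.injective]
  obtain rfl := (StrictMono.range_inj he he').1 hr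
  refine ⟨rfl, Equiv.ext fun a => Fin.succ_injective _ ?_⟩
  rw [← spread_apply he.injective, h, spread_apply he.injective]

/-- The count forces `e` and `e'` to have the same range, hence to be equal, and then only the
identity permutation contributes. So the cycles and the cocycles are dual families. -/
theorem placing_antisym {N m : ℕ} {e e' : Fin m → Fin N} (he : StrictMono e)
    (he' : StrictMono e') : placing e' (antisym e) = if e = e' then 1 else 0 := by
  classical
  have key : ∀ σ, (∀ a, spread e σ (e' a) = a.succ) ↔ e = e' ∧ σ = 1 := by
    intro σ
    constructor
    · intro h
      have hr : Set.range e' = Set.range e := by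
        have hsub : Set.range e' ⊆ Set.range e := by
          rintro _ ⟨a, rfl⟩
          by_contra hx
          rw [← spread_eq_zero_iff he.injective σ, h] at hx
          exact Fin.succ_ne_zero _ hx
        refine Set.eq_of_subset_of_ncard_le hsub ?_
        rw [← Set.image_univ, ← Set.image_univ, Set.ncard_image_of_injective _ he.injective,
          Set.ncard_image_of_injective _ he'.injective]
      obtain rfl := (StrictMono.range_inj he' he).1 hr
      refine ⟨rfl, Equiv.ext fun a => Fin.succ_injective _ ?_⟩
      rw [← spread_apply he'.injective, h, Equiv.Perm.one_apply]
    · rintro ⟨rfl, rfl⟩ a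
      rw [spread_apply he.injective, Equiv.Perm.one_apply]
  simp only [antisym, map_sum, map_smul, placing_single, key]
  by_cases h : e = e'
  · simp only [h, true_and, smul_eq_mul, mul_ite, mul_one, mul_zero, Finset.sum_ite_eq',
      Finset.mem_univ, if_true, Equiv.Perm.sign_one, Units.val_one, Int.cast_one]
  · simp [h]

/-! ### Crowded distributions -/

section Crowded

/-- Some slot contains at least `k` elements. -/
def Crowded {ι : Type*} [Fintype ι] {m : ℕ} (k : ℕ) (f : ι → Fin (m + 1)) : Prop :=
  ∃ j, k ≤ (Finset.univ.filter fun x => f x = j).card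

theorem Crowded.comp {ι : Type*} [Fintype ι] {m l k : ℕ} {f : ι → Fin (m + 1)} (hf : Crowded k f)
    (φ : Fin (m + 1) → Fin (l + 1)) : Crowded k (φ ∘ f) := by
  obtain ⟨j, hj⟩ := hf
  refine ⟨φ j, hj.trans (Finset.card_le_card fun x hx => ?_)⟩
  simp only [Finset.mem_filter, Finset.mem_univ, true_and] at hx ⊢
  rw [Function.comp_apply, hx]

variable {N : ℕ}

/-- The distribution with an additional element `0` in slot `0`. -/
def pin {m : ℕ} (g : Fin N → Fin (m + 1)) : Fin (N + 1) → Fin (m + 1) := Fin.cons 0 g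

@[simp] theorem pin_zero {m : ℕ} (g : Fin N → Fin (m + 1)) : pin g 0 = 0 := rfl

@[simp] theorem pin_succ {m : ℕ} (g : Fin N → Fin (m + 1)) (x : Fin N) : pin g x.succ = g x := rfl

theorem comp_pin {m l : ℕ} (g : Fin N → Fin (m + 1)) (φ : Fin (m + 1) → Fin (l + 1))
    (hφ : φ 0 = 0) : φ ∘ pin g = pin (φ ∘ g) := by
  funext x
  cases x using Fin.cases
  · exact hφ
  · rfl

theorem merge_zero (m i : ℕ) : merge m i 0 = 0 := by
  apply Fin.ext
  simp [merge_val]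

theorem insertSlot_zero (m : ℕ) {j : ℕ} (hj : 1 ≤ j) : insertSlot m j 0 = 0 := by
  apply Fin.ext
  rw [insertSlot_val, Fin.val_zero, if_pos (by omega), Fin.val_zero]

/-- The chains with at least `k` elements, including the pinned one, in some slot. -/
noncomputable def crowdedChains (N k m : ℕ) : Submodule ℂ (SlotChain (Fin N) m) :=
  Finsupp.supported ℂ ℂ {g | Crowded k (pin g)}

theorem slotBoundary_mem_crowdedChains {k m : ℕ} {c : SlotChain (Fin N) (m + 1)}
    (hc : c ∈ crowdedChains N k (m + 1)) : slotBoundary _ m c ∈ crowdedChains N k m := by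
  suffices h : crowdedChains N k (m + 1) ≤ (crowdedChains N k m).comap (slotBoundary _ m) from h hc
  rw [crowdedChains, Finsupp.supported_eq_span_single, Submodule.span_le]
  rintro _ ⟨f, hf, rfl⟩
  rw [SetLike.mem_coe, Submodule.mem_comap, slotBoundary_single]
  refine Submodule.sum_mem _ fun i _ => Finsupp.single_mem_supported ℂ _ ?_
  have hf' : Crowded k (pin f) := hf
  change Crowded k (pin (merge m i ∘ f))
  rw [← comp_pin _ _ (merge_zero m i)]
  exact hf'.comp _

/-- A cycle of degenerate crowded distributions is the boundary of a crowded chain. -/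
theorem exists_crowded_of_degenerate {k m : ℕ} {c : SlotChain (Fin N) m}
    (hc : c ∈ crowdedChains N k m) (hd : c ∈ Finsupp.supported ℂ ℂ {g | Degenerate g})
    (hcyc : c ∈ slotCycles (Fin N) m) :
    ∃ y ∈ crowdedChains N k (m + 1), slotBoundary _ m y = c := by
  refine exists_slotBoundary_eq_of_degenerate (fun m g => Crowded k (pin g)) ?_ m ?_ hcyc
  · intro m j g hj hg
    rw [← comp_pin _ _ (insertSlot_zero m hj)]
    exact hg.comp _
  · rw [crowdedChains, Finsupp.mem_supported] at hc
    rw [Finsupp.mem_supported] at hd ⊢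
    exact fun x hx => ⟨hd hx, hc hx⟩

theorem pin_surjective {m : ℕ} {g : Fin N → Fin (m + 1)} (hg : ¬ Degenerate g) :
    Function.Surjective (pin g) := by
  intro j
  by_cases hj : j = 0
  · exact ⟨0, hj.symm⟩
  · by_contra h
    push Not at h
    exact hg ⟨j, hj, fun x hx => h x.succ hx⟩

theorem card_filter_ne_image {m : ℕ} {f : Fin (N + 1) → Fin (m + 1)} (hf : Function.Surjective f)
    (j : Fin (m + 1)) : ((Finset.univ.filter fun x => f x ≠ j).image f).card = m := by
  have : (Finset.univ.filter fun x => f x ≠ j).image f = Finset.univ.erase j := by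
    ext i
    simp only [Finset.mem_image, Finset.mem_filter, Finset.mem_univ, true_and, Finset.mem_erase,
      and_true]
    constructor
    · rintro ⟨x, hx, rfl⟩
      exact hx
    · intro hi
      obtain ⟨x, rfl⟩ := hf i
      exact ⟨x, hi, rfl⟩
  rw [this, Finset.card_erase_of_mem (Finset.mem_univ _), Finset.card_univ, Fintype.card_fin,
    Nat.add_sub_cancel]

/-- With `k` elements in one slot, fewer than `m` elements remain for the other `m` slots. -/
theorem degenerate_of_crowded {k m : ℕ} (h : N + 1 < k + m) {g : Fin N → Fin (m + 1)}
    (hg : Crowded k (pin g)) : Degenerate g := by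
  by_contra hd
  obtain ⟨j, hj⟩ := hg
  have h1 := card_filter_ne_image (pin_surjective hd) j
  have h2 := Finset.card_image_le (s := Finset.univ.filter fun x => pin g x ≠ j) (f := pin g)
  have h3 := Finset.card_filter_add_card_filter_not (s := Finset.univ) (fun x => pin g x = j)
  rw [Finset.card_univ, Fintype.card_fin] at h3
  simp only [ne_eq] at h1 h2
  omega

theorem crowdedChains_le_degenerate {k m : ℕ} (h : N + 1 < k + m) :
    crowdedChains N k m ≤ Finsupp.supported ℂ ℂ {g | Degenerate g} :=
  Finsupp.supported_mono fun _ hg => degenerate_of_crowded h hg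

/-- In the top degree, a nondegenerate crowded distribution has one slot with `k` elements and
all other slots are singletons. -/
theorem exists_big_slot {k t : ℕ} (h : N + 1 = k + t) {g : Fin N → Fin (t + 1)}
    (hg : Crowded k (pin g)) (hd : ¬ Degenerate g) :
    ∃ j, (Finset.univ.filter fun x => pin g x = j).card = k ∧
      ∀ x y, pin g x ≠ j → pin g y = pin g x → y = x := by
  obtain ⟨j, hj⟩ := hg
  have h1 := card_filter_ne_image (pin_surjective hd) j
  have h2 := Finset.card_image_le (s := Finset.univ.filter fun x => pin g x ≠ j) (f := pin g)
  have h3 := Finset.card_filter_add_card_filter_not (s := Finset.univ) (fun x => pin g x = j)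
  rw [Finset.card_univ, Fintype.card_fin] at h3
  simp only [ne_eq] at h1 h2
  refine ⟨j, by omega, fun x y hx hy => ?_⟩
  have hinj : Set.InjOn (pin g) (Finset.univ.filter fun x => ¬ pin g x = j) :=
    Finset.card_image_iff.1 (by omega)
  exact hinj (by simpa [hy] using hx) (by simpa using hx) hy

theorem slotBoundary_apply {ι : Type*} [Fintype ι] [DecidableEq ι] {m : ℕ}
    (c : SlotChain ι (m + 1)) (h : ι → Fin (m + 1)) :
    slotBoundary ι m c h = ∑ g : ι → Fin (m + 2), ∑ i ∈ Finset.range (m + 2),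
      if merge m i ∘ g = h then (-1 : ℂ) ^ i * c g else 0 := by
  classical
  have hc : c = ∑ g : ι → Fin (m + 2), c g • Finsupp.single g 1 := by
    conv_lhs => rw [← Finsupp.univ_sum_single c]
    exact Finset.sum_congr rfl fun g _ => by rw [Finsupp.smul_single, smul_eq_mul, mul_one]
  conv_lhs => rw [hc]
  rw [map_sum, Finsupp.finsetSum_apply]
  refine Finset.sum_congr rfl fun g _ => ?_
  rw [map_smul, slotBoundary_single, Finsupp.smul_apply, Finsupp.finsetSum_apply, smul_eq_mul,
    Finset.mul_sum]
  refine Finset.sum_congr rfl fun i _ => ?_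
  rw [Finsupp.single_apply, mul_ite, mul_zero, mul_comm]

/-- If `h` is a face of only one distribution in the support of `c`, in only one way, then the
coefficient of `h` in the boundary is, up to sign, the coefficient of that distribution. -/
theorem eq_zero_of_slotBoundary_apply {ι : Type*} [Fintype ι] {m i : ℕ}
    (c : SlotChain ι (m + 1)) (h : ι → Fin (m + 1)) (g : ι → Fin (m + 2)) (hi : i < m + 2)
    (hgi : merge m i ∘ g = h) (hch : slotBoundary ι m c h = 0)
    (huniq : ∀ g' i', i' < m + 2 → c g' ≠ 0 → merge m i' ∘ g' = h → g' = g ∧ i' = i) :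
    c g = 0 := by
  classical
  by_contra hne
  rw [slotBoundary_apply, Finset.sum_eq_single g, Finset.sum_eq_single i, if_pos hgi] at hch
  · simp [hne] at hch
  · intro i' hi' hne'
    rw [if_neg]
    exact fun h' => hne' (huniq g i' (Finset.mem_range.1 hi') hne h').2
  · exact fun h' => absurd (Finset.mem_range.2 hi) h'
  · intro g' _ hg'
    refine Finset.sum_eq_zero fun i' hi' => ?_
    by_cases h0 : c g' = 0
    · rw [h0, mul_zero, ite_self]
    · rw [if_neg]
      exact fun h' => hg' (huniq g' i' (Finset.mem_range.1 hi') h0 h').1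
  · exact fun h' => absurd (Finset.mem_univ _) h'

end Crowded

/-! ### Exchanging neighbouring singletons in a crowded cycle of top degree -/

section TopDegree

variable {N k t : ℕ}

theorem not_degenerate_merge {ι : Type*} {m i : ℕ} {g : ι → Fin (m + 2)} (hg : ¬ Degenerate g) :
    ¬ Degenerate (merge m i ∘ g) := by
  rintro ⟨j, hj, h⟩
  have hj' : (j : ℕ) ≠ 0 := fun h => hj (Fin.ext h)
  have hlt := j.isLt
  refine hg ⟨⟨if (j : ℕ) ≤ i then j else j + 1, by split_ifs <;> omega⟩, fun h0 => ?_,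
    fun x hx => h x ?_⟩
  · have h1 := Fin.ext_iff.1 h0
    dsimp only [Fin.val_zero] at h1
    split_ifs at h1
    omega
  · have h1 := Fin.ext_iff.1 hx
    apply Fin.ext
    rw [Function.comp_apply, merge_val, h1]
    dsimp only
    split_ifs <;> omega

/-- Elements that share a slot lie in the big slot, which has at least three elements. This is where
`3 ≤ k` is used in full: a slot obtained by merging two singletons cannot be mistaken for the big
slot. -/
theorem exists_third {m : ℕ} (hk : 3 ≤ k) (h : N + 1 = k + m) {g : Fin N → Fin (m + 1)}
    (hg : Crowded k (pin g)) (hd : ¬ Degenerate g) {x y : Fin (N + 1)} (hxy : x ≠ y)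
    (he : pin g x = pin g y) : ∃ v, v ≠ x ∧ v ≠ y ∧ pin g v = pin g x := by
  obtain ⟨j, hj, hs⟩ := exists_big_slot h hg hd
  have hx : pin g x = j := by
    by_contra hx
    exact hxy (hs x y hx he.symm).symm
  have hcard : 0 < (((Finset.univ.filter fun v => pin g v = j).erase x).erase y).card := by
    have h1 := Finset.pred_card_le_card_erase (s := Finset.univ.filter fun v => pin g v = j) (a := x)
    have h2 := Finset.pred_card_le_card_erase
      (s := (Finset.univ.filter fun v => pin g v = j).erase x) (a := y)
    omega
  obtain ⟨v, hv⟩ := Finset.card_pos.1 hcard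
  simp only [Finset.mem_erase, Finset.mem_filter, Finset.mem_univ, true_and] at hv
  exact ⟨v, hv.2.1, hv.1, by rw [hv.2.2, hx]⟩

/-- The element `x` is alone in its slot. -/
def Alone {m : ℕ} (g : Fin N → Fin (m + 1)) (x : Fin (N + 1)) : Prop :=
  ∀ v, pin g v = pin g x → v = x

theorem pin_eq_of_merge {m i i' : ℕ} {g g' : Fin N → Fin (m + 2)}
    (h : merge m i' ∘ g' = merge m i ∘ g) (v : Fin (N + 1)) :
    merge m i' (pin g' v) = merge m i (pin g v) := by
  have := congrArg pin h
  rw [← comp_pin _ _ (merge_zero m i), ← comp_pin _ _ (merge_zero m i')] at this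
  exact congrFun this v

/-- Among nondegenerate crowded distributions, the face merging the singletons `x` and `y` comes
only from `g` and from `g` with `x` and `y` exchanged, since `exists_third` forbids them to share a
slot. If one of the two coefficients vanished, the cycle condition would make the other vanish. -/
theorem ne_zero_swap (hk : 3 ≤ k) (hN : N + 1 = k + (t + 1)) {c : SlotChain (Fin N) (t + 1)}
    (hsupp : ∀ g, c g ≠ 0 → Crowded k (pin g) ∧ ¬ Degenerate g)
    (hc : ∀ h, ¬ Degenerate h → slotBoundary _ t c h = 0) {g : Fin N → Fin (t + 2)}
    (hg : c g ≠ 0) {x y : Fin (N + 1)} (hx0 : (pin g x : ℕ) ≠ 0)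
    (hxy : (pin g y : ℕ) = pin g x + 1) (hx : Alone g x) (hy : Alone g y) :
    c (Equiv.swap (pin g x) (pin g y) ∘ g) ≠ 0 := by
  intro h2
  have hlty := (pin g y).isLt
  refine hg (eq_zero_of_slotBoundary_apply c (merge t (pin g x) ∘ g) g (i := pin g x) (by omega) rfl
    (hc _ (not_degenerate_merge (hsupp g hg).2)) fun g' i' hi' hg' hm => ?_)
  have hne : x ≠ y := by
    rintro rfl
    omega
  have hm' := pin_eq_of_merge hm
  have hval : ∀ v, (merge t i' (pin g' v) : ℕ) = merge t (pin g x) (pin g v) := fun v => by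
    rw [hm']
  have hother : ∀ v, v ≠ x → v ≠ y → (pin g v : ℕ) ≠ pin g x ∧ (pin g v : ℕ) ≠ pin g x + 1 :=
    fun v hvx hvy => ⟨fun h => hvx (hx v (Fin.ext h)), fun h => hvy (hy v (Fin.ext (by omega)))⟩
  simp only [merge_val] at hval
  have hne' : (pin g' x : ℕ) ≠ pin g' y := by
    intro h
    obtain ⟨v, hvx, hvy, hv⟩ := exists_third hk hN (hsupp g' hg').1 (hsupp g' hg').2 hne (Fin.ext h)
    have h1 := hval x
    have h3 := hval v
    have h4 := hother v hvx hvy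
    have := (pin g v).isLt
    rw [hv, h1] at h3
    split_ifs at h3 <;> omega
  have hx' := hval x
  have hy' := hval y
  have hltx' := (pin g' x).isLt
  have hlty' := (pin g' y).isLt
  have hii : i' = pin g x := by
    split_ifs at hx' hy' <;> omega
  subst hii
  have hrest : ∀ v, v ≠ x → v ≠ y → pin g' v = pin g v := by
    intro v hvx hvy
    have h1 := hother v hvx hvy
    have h3 := hval v
    have := (pin g v).isLt
    have := (pin g' v).isLt
    apply Fin.ext
    split_ifs at h3 <;> omega
  refine ⟨?_, rfl⟩
  -- If `x` keeps its slot, then `g' = g`; otherwise `g'` is the exchanged distribution, whose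
  -- coefficient is zero by `h2`.
  by_cases hcase : (pin g' x : ℕ) = pin g x
  · funext v
    rw [← pin_succ g', ← pin_succ g]
    by_cases hvx : v.succ = x
    · rw [hvx]
      exact Fin.ext hcase
    by_cases hvy : v.succ = y
    · rw [hvy]
      apply Fin.ext
      split_ifs at hy' <;> omega
    · exact hrest _ hvx hvy
  · exfalso
    apply hg'
    rw [← h2]
    congr 1
    funext v
    rw [Function.comp_apply, ← pin_succ g', ← pin_succ g]
    by_cases hvx : v.succ = x
    · rw [hvx, Equiv.swap_apply_left]
      apply Fin.ext
      split_ifs at hx' hy' <;> omega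
    by_cases hvy : v.succ = y
    · rw [hvy, Equiv.swap_apply_right]
      apply Fin.ext
      split_ifs at hx' hy' <;> omega
    · rw [hrest _ hvx hvy, Equiv.swap_apply_of_ne_of_ne]
      · exact fun h => hvx (hx _ h)
      · exact fun h => hvy (hy _ h)

/-- Moving the last slot to position `1`. -/
def lastToFront (m : ℕ) (x : Fin (m + 2)) : Fin (m + 2) :=
  ⟨if (x : ℕ) = 0 then 0 else if (x : ℕ) = m + 1 then 1 else x + 1, by
    have := x.isLt
    split_ifs <;> omega⟩

theorem lastToFront_val (m : ℕ) (x : Fin (m + 2)) : (lastToFront m x : ℕ) =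
    if (x : ℕ) = 0 then 0 else if (x : ℕ) = m + 1 then 1 else (x : ℕ) + 1 := rfl

theorem lastToFront_injective (m : ℕ) : Function.Injective (lastToFront m) := by
  intro x y h
  have h1 := Fin.ext_iff.1 h
  rw [lastToFront_val, lastToFront_val] at h1
  apply Fin.ext
  split_ifs at h1 <;> omega

/-- This is the exchange across the cyclic seam, between the last singleton `x` and the pinned
singleton `0`. After rotating `0` back to slot `0`, `x` is in slot `1` and the other slots move up.
The last face of `g` is face `0` of the new distribution, and no other distribution of the support
has it as a face. -/
theorem ne_zero_lastToFront (hk : 3 ≤ k) (hN : N + 1 = k + (t + 1)) {c : SlotChain (Fin N) (t + 1)}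
    (hsupp : ∀ g, c g ≠ 0 → Crowded k (pin g) ∧ ¬ Degenerate g)
    (hc : ∀ h, ¬ Degenerate h → slotBoundary _ t c h = 0) {g : Fin N → Fin (t + 2)}
    (hg : c g ≠ 0) {x : Fin (N + 1)} (hxl : (pin g x : ℕ) = t + 1) (h0 : Alone g 0)
    (hx : Alone g x) : c (lastToFront t ∘ g) ≠ 0 := by
  intro h2
  refine hg (eq_zero_of_slotBoundary_apply c (merge t (t + 1) ∘ g) g (i := t + 1) (by omega) rfl
    (hc _ (not_degenerate_merge (hsupp g hg).2)) fun g' i' hi' hg' hm => ?_)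
  have hne : 0 ≠ x := by
    rintro rfl
    rw [pin_zero, Fin.val_zero] at hxl
    omega
  have hm' := pin_eq_of_merge hm
  have hval : ∀ v, (merge t i' (pin g' v) : ℕ) = merge t (t + 1) (pin g v) := fun v => by
    rw [hm']
  have hother : ∀ v, v ≠ 0 → v ≠ x → (pin g v : ℕ) ≠ 0 ∧ (pin g v : ℕ) ≠ t + 1 :=
    fun v hv0 hvx => ⟨fun h => hv0 (h0 v (Fin.ext h)), fun h => hvx (hx v (Fin.ext (by omega)))⟩
  simp only [merge_val] at hval
  have hne' : (pin g' x : ℕ) ≠ 0 := by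
    intro h
    obtain ⟨v, hv0, hvx, hv⟩ := exists_third hk hN (hsupp g' hg').1 (hsupp g' hg').2 hne
      (Fin.ext h.symm)
    have h3 := hval v
    have h4 := hother v hv0 hvx
    have := (pin g v).isLt
    rw [hv, pin_zero, Fin.val_zero] at h3
    split_ifs at h3 <;> omega
  have hx' := hval x
  have hltx' := (pin g' x).isLt
  have hcases : (i' = t + 1 ∧ (pin g' x : ℕ) = t + 1) ∨ (i' = 0 ∧ (pin g' x : ℕ) = 1) := by
    split_ifs at hx' <;> omega
  have hzero : ∀ v : Fin N, v.succ ≠ 0 := fun v => Fin.succ_ne_zero v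
  rcases hcases with ⟨rfl, hx1⟩ | ⟨rfl, hx1⟩
  · refine ⟨?_, rfl⟩
    funext v
    rw [← pin_succ g', ← pin_succ g]
    by_cases hvx : v.succ = x
    · rw [hvx]
      exact Fin.ext (by omega)
    · have h1 := hother _ (hzero v) hvx
      have h3 := hval v.succ
      have := (pin g v.succ).isLt
      have := (pin g' v.succ).isLt
      apply Fin.ext
      split_ifs at h3 <;> omega
  · exfalso
    apply hg'
    rw [← h2]
    congr 1
    funext v
    rw [Function.comp_apply, ← pin_succ g', ← pin_succ g]
    apply Fin.ext
    rw [lastToFront_val]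
    by_cases hvx : v.succ = x
    · rw [hvx, if_neg (by omega), if_pos hxl, hx1]
    · have h1 := hother _ (hzero v) hvx
      have h3 := hval v.succ
      have := (pin g v.succ).isLt
      have := (pin g' v.succ).isLt
      split_ifs at h3 ⊢ <;> omega

end TopDegree

/-! ### Top-degree crowded cycles are detected by the standard coefficients -/

section Detection

variable {N k : ℕ}

/-- Slot `j` has `k` elements and all elements of other slots are alone. -/
def BigSlot (k : ℕ) {m : ℕ} (g : Fin N → Fin (m + 1)) (j : Fin (m + 1)) : Prop :=
  (Finset.univ.filter fun x => pin g x = j).card = k ∧ ∀ x, pin g x ≠ j → Alone g x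

theorem BigSlot.comp {m : ℕ} {g : Fin N → Fin (m + 1)} {j : Fin (m + 1)} (h : BigSlot k g j)
    {φ : Fin (m + 1) → Fin (m + 1)} (hφ : Function.Injective φ) (h0 : φ 0 = 0) :
    BigSlot k (φ ∘ g) (φ j) := by
  simp only [BigSlot, Alone, ← comp_pin g φ h0, Function.comp_apply, hφ.eq_iff, hφ.ne_iff]
  exact h

/-- Making the distribution relative to the slot of the element `0`. -/
def unpin {m : ℕ} (f : Fin (N + 1) → Fin (m + 1)) : Fin N → Fin (m + 1) := fun x => f x.succ - f 0

theorem unpin_pin {m : ℕ} (g : Fin N → Fin (m + 1)) : unpin (pin g) = g := by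
  funext x
  simp [unpin]

theorem pin_unpin {m : ℕ} (f : Fin (N + 1) → Fin (m + 1)) : pin (unpin f) = fun x => f x - f 0 := by
  funext x
  cases x using Fin.cases <;> simp [unpin]

/-- While the big slot is neither first nor last, both the pinned element and the last slot are
singletons, so `lastToFront` applies and moves the big slot up by one. The number `d` counts the
remaining steps. -/
theorem exists_bigSlot_extreme (hk : 3 ≤ k) {t : ℕ} (hN : N + 1 = k + (t + 1))
    {c : SlotChain (Fin N) (t + 1)}
    (hsupp : ∀ g, c g ≠ 0 → Crowded k (pin g) ∧ ¬ Degenerate g)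
    (hc : ∀ h, ¬ Degenerate h → slotBoundary _ t c h = 0) (d : ℕ) {g : Fin N → Fin (t + 2)}
    (hg : c g ≠ 0) {j : Fin (t + 2)} (hj : BigSlot k g j) (hd : (j : ℕ) + d = t + 1) :
    ∃ g', c g' ≠ 0 ∧ (BigSlot k g' 0 ∨ BigSlot k g' (Fin.last (t + 1))) := by
  induction d generalizing g j with
  | zero =>
    obtain rfl : j = Fin.last (t + 1) := Fin.ext (by simpa using hd)
    exact ⟨g, hg, Or.inr hj⟩
  | succ d ih =>
    by_cases hj0 : j = 0
    · subst hj0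
      exact ⟨g, hg, Or.inl hj⟩
    · have hj0' : (j : ℕ) ≠ 0 := fun h => hj0 (Fin.ext h)
      obtain ⟨x, hx⟩ := pin_surjective (hsupp g hg).2 (Fin.last (t + 1))
      have hxl : (pin g x : ℕ) = t + 1 := by rw [hx, Fin.val_last]
      refine ih (ne_zero_lastToFront hk hN hsupp hc hg hxl (hj.2 _ ?_) (hj.2 _ ?_))
        (hj.comp (lastToFront_injective t) ?_) ?_
      · rw [pin_zero]
        exact fun h => hj0 h.symm
      · intro h
        rw [h] at hxl
        omega
      · apply Fin.ext
        simp [lastToFront_val]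
      · rw [lastToFront_val, if_neg hj0', if_neg (by omega)]
        omega

/-- The rearrangement inequality for a single transposition; it makes the weight in `exists_sorted`
grow when a descent is removed. -/
theorem sum_mul_swap_lt {n : ℕ} (F : Fin n → ℕ) {x y : Fin n} (hyx : y < x) (hF : F x < F y) :
    ∑ v : Fin n, (v : ℕ) * F v < ∑ v : Fin n, (v : ℕ) * F (Equiv.swap x y v) := by
  rw [← Finset.add_sum_erase _ _ (Finset.mem_univ x),
    ← Finset.add_sum_erase (Finset.univ.erase x) _ (a := y) (by simp [hyx.ne]),
    ← Finset.add_sum_erase _ (fun v : Fin n => (v : ℕ) * F (Equiv.swap x y v)) (Finset.mem_univ x),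
    ← Finset.add_sum_erase (Finset.univ.erase x)
      (fun v : Fin n => (v : ℕ) * F (Equiv.swap x y v)) (a := y) (by simp [hyx.ne])]
  have hrest : ∑ v ∈ (Finset.univ.erase x).erase y, (v : ℕ) * F (Equiv.swap x y v) =
      ∑ v ∈ (Finset.univ.erase x).erase y, (v : ℕ) * F v := by
    refine Finset.sum_congr rfl fun v hv => ?_
    simp only [Finset.mem_erase] at hv
    rw [Equiv.swap_apply_of_ne_of_ne hv.2.1 hv.1]
  rw [hrest, Equiv.swap_apply_left, Equiv.swap_apply_right, ← add_assoc, ← add_assoc]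
  have hyx' : (y : ℕ) < x := hyx
  obtain ⟨a, ha⟩ := Nat.exists_eq_add_of_lt hyx'
  obtain ⟨b, hb⟩ := Nat.exists_eq_add_of_lt hF
  rw [ha, hb]
  refine Nat.add_lt_add_right ?_ _
  nlinarith

/-- Among the distributions in the support with big slot `j` there is one in which consecutive
other slots contain increasing elements. -/
theorem exists_sorted (hk : 3 ≤ k) {t : ℕ} (hN : N + 1 = k + (t + 1))
    {c : SlotChain (Fin N) (t + 1)}
    (hsupp : ∀ g, c g ≠ 0 → Crowded k (pin g) ∧ ¬ Degenerate g)
    (hc : ∀ h, ¬ Degenerate h → slotBoundary _ t c h = 0) {g : Fin N → Fin (t + 2)}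
    (hg : c g ≠ 0) {j : Fin (t + 2)} (hj : BigSlot k g j) :
    ∃ g', c g' ≠ 0 ∧ BigSlot k g' j ∧ ∀ x y, pin g' x ≠ j → pin g' y ≠ j → (pin g' x : ℕ) ≠ 0 →
      (pin g' y : ℕ) = pin g' x + 1 → x < y := by
  classical
  -- At a maximum of the weight `∑ v * slot v` there is no descent: exchanging one would stay in the
  -- support and increase the weight.
  obtain ⟨g', hg', hmax⟩ := Finset.exists_max_image
    (Finset.univ.filter fun g' : Fin N → Fin (t + 2) => c g' ≠ 0 ∧ BigSlot k g' j)
    (fun g' => ∑ v : Fin (N + 1), (v : ℕ) * (pin g' v : ℕ)) ⟨g, by simp [hg, hj]⟩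
  simp only [Finset.mem_filter, Finset.mem_univ, true_and] at hg' hmax
  refine ⟨g', hg'.1, hg'.2, fun x y hx hy hx0 hxy => ?_⟩
  by_contra hlt
  have hne : x ≠ y := by
    rintro rfl
    omega
  have hyx : y < x := lt_of_le_of_ne (not_lt.1 hlt) hne.symm
  have hx1 := hg'.2.2 x hx
  have hy1 := hg'.2.2 y hy
  have hφ0 : Equiv.swap (pin g' x) (pin g' y) 0 = 0 :=
    Equiv.swap_apply_of_ne_of_ne (fun h => hx0 (by rw [← h, Fin.val_zero]))
      (fun h => by rw [← h, Fin.val_zero] at hxy; omega)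
  have h2 := hmax (Equiv.swap (pin g' x) (pin g' y) ∘ g')
    ⟨ne_zero_swap hk hN hsupp hc hg'.1 hx0 hxy hx1 hy1, by
      have := hg'.2.comp (Equiv.injective (Equiv.swap (pin g' x) (pin g' y))) hφ0
      rwa [Equiv.swap_apply_of_ne_of_ne hx.symm hy.symm] at this⟩
  refine absurd h2 (not_le.2 ?_)
  have hswap : ∀ v, pin (Equiv.swap (pin g' x) (pin g' y) ∘ g') v =
      pin g' (Equiv.swap x y v) := by
    intro v
    rw [← comp_pin _ _ hφ0, Function.comp_apply]
    rcases eq_or_ne v x with rfl | hvx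
    · rw [Equiv.swap_apply_left, Equiv.swap_apply_left]
    rcases eq_or_ne v y with rfl | hvy
    · rw [Equiv.swap_apply_right, Equiv.swap_apply_right]
    · rw [Equiv.swap_apply_of_ne_of_ne hvx hvy, Equiv.swap_apply_of_ne_of_ne]
      · exact fun h => hvx (hx1 _ h)
      · exact fun h => hvy (hy1 _ h)
  simp only [hswap]
  exact sum_mul_swap_lt (fun v => (pin g' v : ℕ)) hyx (by omega)

/-- A crowded cycle of top degree is degenerate if its coefficients at the standard distributions
vanish. -/
theorem mem_degenerate_of_coeff (hk : 3 ≤ k) {t : ℕ} (hN : N + 1 = k + t)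
    {l : SlotChain (Fin N) t} (hl : l ∈ crowdedChains N k t) (hcyc : l ∈ slotCycles (Fin N) t)
    (hcoeff : ∀ e : Fin t → Fin (N + 1), StrictMono e → l (unpin (spread e 1)) = 0) :
    l ∈ Finsupp.supported ℂ ℂ {g | Degenerate g} := by
  classical
  rw [Finsupp.mem_supported']
  intro g hgd
  by_contra hg
  rw [Set.mem_ofPred_eq] at hgd
  cases t with
  | zero =>
    apply hg
    rw [← hcoeff Fin.elim0 fun a => a.elim0]
    congr 1
    funext x
    exact Fin.ext (by omega)
  | succ t =>
    -- Only the nondegenerate part of `l` matters: boundaries of degenerate chains are degenerate,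
    -- so the cycle condition still holds for `c` at nondegenerate distributions.
    set c := l.filter fun g => ¬ Degenerate g with hcdef
    have hsupp : ∀ g, c g ≠ 0 → Crowded k (pin g) ∧ ¬ Degenerate g := by
      intro g hg
      rw [hcdef, Finsupp.filter_apply] at hg
      have hd : ¬ Degenerate g := fun h => hg (if_neg (not_not.2 h))
      rw [if_pos hd] at hg
      exact ⟨(Finsupp.mem_supported ℂ l).1 hl (Finsupp.mem_support_iff.2 hg), hd⟩
    have hc : ∀ h, ¬ Degenerate h → slotBoundary _ t c h = 0 := by
      intro h hh
      have h1 : slotBoundary _ t (l.filter Degenerate) h = 0 := by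
        refine (Finsupp.mem_supported' ℂ _).1 (slotBoundary_mem_degenerate ?_) h hh
        rw [Finsupp.mem_supported']
        intro g hg
        exact if_neg hg
      have h2 : slotBoundary _ t (l.filter Degenerate + c) = 0 := by
        rw [hcdef, Finsupp.filter_add_filter_not]
        exact hcyc
      rw [map_add] at h2
      have h3 := DFunLike.congr_fun h2 h
      rwa [Finsupp.add_apply, h1, zero_add, Finsupp.zero_apply] at h3
    have hcg : c g ≠ 0 := by rwa [hcdef, Finsupp.filter_apply, if_pos hgd]
    have hcl : ∀ g, c g ≠ 0 → l g ≠ 0 := by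
      intro g hg
      rw [hcdef, Finsupp.filter_apply] at hg
      rwa [if_pos fun h => hg (if_neg (not_not.2 h))] at hg
    obtain ⟨j, hj1, hj2⟩ := exists_big_slot hN (hsupp g hcg).1 (hsupp g hcg).2
    have hj : BigSlot k g j := ⟨hj1, fun x hx v hv => hj2 x v hx hv⟩
    obtain ⟨g₁, hg₁, hbig⟩ := exists_bigSlot_extreme hk hN hsupp hc (t + 1 - j) hcg hj (by omega)
    rcases hbig with hbig | hbig
    -- The big slot is slot `0`: the sorted singletons fill the other slots, so `g'` is already
    -- standard and `e` avoids the element `0`.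
    · obtain ⟨g', hg', hb, hsort⟩ := exists_sorted hk hN hsupp hc hg₁ hbig
      choose e he using fun a : Fin (t + 1) => pin_surjective (hsupp g' hg').2 a.succ
      have hmono : StrictMono e := by
        rw [Fin.strictMono_iff_lt_succ]
        intro i
        refine hsort _ _ ?_ ?_ ?_ ?_ <;> simp [he]
      have heq : spread e 1 = pin g' := by
        funext v
        by_cases hv : pin g' v = 0
        · rw [hv, spread_eq_zero_iff hmono.injective]
          rintro ⟨a, rfl⟩
          rw [he] at hv
          exact Fin.succ_ne_zero _ hv
        · obtain ⟨a, ha⟩ := Fin.exists_succ_eq.2 hv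
          obtain rfl : e a = v := hb.2 v hv _ (by rw [he, ha])
          rw [spread_apply hmono.injective, he, Equiv.Perm.one_apply]
      apply hcl _ hg'
      rw [← hcoeff e hmono, heq, unpin_pin]
    -- The big slot is the last one: the pinned element is the singleton of slot `0`. Rotating by
    -- one slot gives a standard distribution with `e 0 = 0`.
    · obtain ⟨g', hg', hb, hsort⟩ := exists_sorted hk hN hsupp hc hg₁ hbig
      choose e he using fun a : Fin (t + 1) => pin_surjective (hsupp g' hg').2 a.castSucc
      have hlast : ∀ a : Fin (t + 1), a.castSucc ≠ Fin.last (t + 1) := fun a =>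
        (Fin.castSucc_lt_last a).ne
      have he0 : e 0 = 0 := hb.2 0 (by rw [pin_zero]; exact hlast 0) _ (by rw [he]; rfl)
      have hinj : Function.Injective e := fun a b hab => Fin.castSucc_injective _ (by
        rw [← he, ← he, hab])
      have hmono : StrictMono e := by
        rw [Fin.strictMono_iff_lt_succ]
        intro i
        by_cases hi : i.castSucc = 0
        · rw [hi, he0, Fin.pos_iff_ne_zero, ← he0]
          exact fun h => (Fin.succ_ne_zero i) (hinj h)
        · refine hsort _ _ ?_ ?_ ?_ ?_
          · rw [he]; exact hlast _
          · rw [he]; exact hlast _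
          · rw [he]
            exact fun h => hi (Fin.ext h)
          · simp [he]
      have heq : unpin (spread e 1) = g' := by
        funext x
        have h0 : spread e 1 0 = 1 := by
          conv_lhs => rw [← he0]
          rw [spread_apply hinj]
          rfl
        rw [unpin, h0]
        by_cases hv : pin g' x.succ = Fin.last (t + 1)
        · have h1 : spread e 1 x.succ = 0 := by
            rw [spread_eq_zero_iff hinj]
            rintro ⟨a, ha⟩
            rw [← ha, he] at hv
            exact hlast _ hv
          rw [h1, ← pin_succ g', hv, sub_eq_iff_eq_add]
          simp
        · obtain ⟨a, ha⟩ := Fin.exists_castSucc_eq.2 hv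
          have hx : e a = x.succ := hb.2 _ hv _ (by rw [he, ha])
          rw [← hx, spread_apply hinj, ← pin_succ g', ← ha, Equiv.Perm.one_apply,
            sub_eq_iff_eq_add]
          simp
      apply hcl _ hg'
      rw [← hcoeff e hmono, heq]

end Detection

/-! ### Rotating the element `0` into slot `0` -/

section Rotation

variable {N : ℕ}

/-- Rotating a distribution until the element `0` is in slot `0`, with the cyclic sign. -/
noncomputable def unpinChain (N m : ℕ) : SlotChain (Fin (N + 1)) m →ₗ[ℂ] SlotChain (Fin N) m :=
  Finsupp.linearCombination ℂ fun f => Finsupp.single (unpin f) ((-1 : ℂ) ^ (m * (f 0 : ℕ)))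

theorem unpinChain_single {m : ℕ} (f : Fin (N + 1) → Fin (m + 1)) (r : ℂ) :
    unpinChain N m (Finsupp.single f r) =
      Finsupp.single (unpin f) (r * (-1 : ℂ) ^ (m * (f 0 : ℕ))) := by
  simp [unpinChain]

theorem unpinChain_single_pin {m : ℕ} (g : Fin N → Fin (m + 1)) (r : ℂ) :
    unpinChain N m (Finsupp.single (pin g) r) = Finsupp.single g r := by
  rw [unpinChain_single, unpin_pin, pin_zero, Fin.val_zero, mul_zero, pow_zero, mul_one]

theorem unpinChain_rotate {m : ℕ} (f : Fin (N + 1) → Fin (m + 1)) (r : ℂ) :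
    unpinChain N m (Finsupp.single (fun x => f x + 1) r) =
      (-1 : ℂ) ^ m • unpinChain N m (Finsupp.single f r) := by
  rw [unpinChain_single, unpinChain_single, Finsupp.smul_single]
  have h : unpin (fun x => f x + 1) = unpin f := by
    funext x
    simp [unpin]
  rw [h, smul_eq_mul, Fin.val_add_one]
  congr 1
  split_ifs with hl
  -- At the wrap-around the exponent `m * m` drops to `0`; the signs agree because `m + m * m` is
  -- even.
  · rw [hl, Fin.val_last, mul_zero, pow_zero, mul_left_comm, ← pow_add, Even.neg_one_pow]
    obtain ⟨a, ha⟩ := Nat.even_mul_succ_self m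
    exact ⟨a, by rw [← ha]; ring⟩
  · ring

theorem merge_succ_add_one {m i : ℕ} (hi : i ≤ m) (x : Fin (m + 2)) :
    merge m (i + 1) (x + 1) = merge m i x + 1 := by
  apply Fin.ext
  have := x.isLt
  rw [Fin.val_add_one, merge_val, merge_val, Fin.val_add_one]
  simp only [Fin.ext_iff, Fin.val_last, merge_val]
  split_ifs <;> omega

theorem merge_zero_add_one {m : ℕ} (x : Fin (m + 2)) :
    merge m 0 (x + 1) = merge m (m + 1) x := by
  apply Fin.ext
  have := x.isLt
  rw [merge_val, merge_val, Fin.val_add_one]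
  simp only [Fin.ext_iff, Fin.val_last]
  split_ifs <;> omega

/-- Face `i + 1` of the rotated distribution is the rotation of face `i`, and its face `0` is the
last face of the original. -/
theorem unpinChain_slotBoundary_rotate {m : ℕ} (f : Fin (N + 1) → Fin (m + 2)) :
    unpinChain N m (slotBoundary _ m (Finsupp.single (fun x => f x + 1) 1)) =
      (-1 : ℂ) ^ (m + 1) • unpinChain N m (slotBoundary _ m (Finsupp.single f 1)) := by
  rw [slotBoundary_single, slotBoundary_single, Finset.sum_range_succ',
    Finset.sum_range_succ (n := m + 1), map_add, map_add, map_sum, map_sum, smul_add, Finset.smul_sum]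
  congr 1
  · refine Finset.sum_congr rfl fun i hi => ?_
    have h : merge m (i + 1) ∘ (fun x => f x + 1) = fun x => (merge m i ∘ f) x + 1 :=
      funext fun x => merge_succ_add_one (by have := Finset.mem_range.1 hi; omega) (f x)
    rw [h, unpinChain_rotate, pow_succ, pow_succ, mul_neg_one, mul_neg_one, Finsupp.single_neg,
      map_neg, smul_neg, neg_smul]
  · have h : merge m 0 ∘ (fun x => f x + 1) = merge m (m + 1) ∘ f :=
      funext fun x => merge_zero_add_one (f x)
    rw [h, ← map_smul, Finsupp.smul_single, smul_eq_mul, ← pow_add, pow_zero,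
      Even.neg_one_pow ⟨m + 1, rfl⟩]

/-- Both sides acquire the same sign under rotation, so induction on the slot of the element `0`
reduces to slot `0`, where no rotation is needed. -/
theorem slotBoundary_unpinChain {m : ℕ} (c : SlotChain (Fin (N + 1)) (m + 1)) :
    slotBoundary _ m (unpinChain N (m + 1) c) = unpinChain N m (slotBoundary _ m c) := by
  suffices h : slotBoundary _ m ∘ₗ unpinChain N (m + 1) = unpinChain N m ∘ₗ slotBoundary _ m from
    LinearMap.congr_fun h c
  refine SlotChain.hom_ext fun f => ?_
  rw [LinearMap.comp_apply, LinearMap.comp_apply]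
  obtain ⟨n, hn⟩ : ∃ n, (f 0 : ℕ) = n := ⟨_, rfl⟩
  induction n generalizing f with
  | zero =>
    have hf : f = pin (Fin.tail f) := by
      rw [pin, ← show f 0 = 0 from Fin.ext hn, Fin.cons_self_tail]
    rw [hf, unpinChain_single_pin, slotBoundary_single, slotBoundary_single, map_sum]
    refine Finset.sum_congr rfl fun i _ => ?_
    rw [comp_pin _ _ (merge_zero m i), unpinChain_single_pin]
  | succ n ih =>
    have hf : f = fun x => (f x - 1) + 1 := by
      funext x
      simp
    have hval : ((f 0 - 1 : Fin (m + 2)) : ℕ) = n := by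
      have h1 : ((f 0 - 1 : Fin (m + 2)) + 1 : Fin (m + 2)) = f 0 := by simp
      have h2 := Fin.val_add_one (f 0 - 1)
      rw [h1, hn] at h2
      split_ifs at h2
      omega
    rw [hf, unpinChain_rotate, map_smul, ih _ hval, unpinChain_slotBoundary_rotate]

theorem unpinChain_mem_slotCycles {m : ℕ} {c : SlotChain (Fin (N + 1)) m}
    (hc : c ∈ slotCycles _ m) : unpinChain N m c ∈ slotCycles _ m := by
  cases m with
  | zero => trivial
  | succ m =>
    change slotBoundary _ m (unpinChain N (m + 1) c) = 0
    rw [slotBoundary_unpinChain, show slotBoundary _ m c = 0 from hc, map_zero]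

theorem card_spread_eq_zero {n m : ℕ} {e : Fin m → Fin n} (he : Function.Injective e)
    (σ : Equiv.Perm (Fin m)) : (Finset.univ.filter fun x => spread e σ x = 0).card = n - m := by
  classical
  have : (Finset.univ.filter fun x => spread e σ x = 0) = (Finset.univ.image e)ᶜ := by
    ext x
    simp [spread_eq_zero_iff he]
  rw [this, Finset.card_compl, Finset.card_image_of_injective _ he]
  simp

theorem crowded_spread {k t n : ℕ} (hn : n = k + t) {e : Fin t → Fin n}
    (he : Function.Injective e) (σ : Equiv.Perm (Fin t)) : Crowded k (spread e σ) :=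
  ⟨0, by rw [card_spread_eq_zero he]; omega⟩

theorem unpinChain_antisym_mem {k t : ℕ} (hN : N + 1 = k + t) {e : Fin t → Fin (N + 1)}
    (he : Function.Injective e) : unpinChain N t (antisym e) ∈ crowdedChains N k t := by
  rw [antisym, map_sum]
  refine Submodule.sum_mem _ fun σ _ => ?_
  rw [map_smul, unpinChain_single]
  refine Submodule.smul_mem _ _ (Finsupp.single_mem_supported ℂ _ ?_)
  change Crowded k (pin (unpin (spread e σ)))
  rw [pin_unpin]
  exact (crowded_spread hN he σ).comp (fun x => x - spread e σ 0)

theorem pin_spread {m : ℕ} {e : Fin m → Fin N} (he : Function.Injective e)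
    (σ : Equiv.Perm (Fin m)) : pin (spread e σ) = spread (Fin.succ ∘ e) σ := by
  have he' : Function.Injective (Fin.succ ∘ e) := (Fin.succ_injective N).comp he
  funext x
  by_cases hx : x ∈ Set.range (Fin.succ ∘ e)
  · obtain ⟨a, rfl⟩ := hx
    rw [spread_apply he', Function.comp_apply, pin_succ, spread_apply he]
  · rw [(spread_eq_zero_iff he' σ x).2 hx]
    cases x using Fin.cases with
    | zero => rfl
    | succ x =>
      rw [pin_succ, spread_eq_zero_iff he]
      rintro ⟨a, rfl⟩
      exact hx ⟨a, rfl⟩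

theorem antisym_mem_crowdedChains {k t : ℕ} (hN : N + 1 = k + t) {e : Fin t → Fin N}
    (he : Function.Injective e) : antisym e ∈ crowdedChains N k t := by
  rw [antisym]
  refine Submodule.sum_mem _ fun σ _ => Submodule.smul_mem _ _ (Finsupp.single_mem_supported ℂ _ ?_)
  change Crowded k (pin (spread e σ))
  rw [pin_spread he]
  exact crowded_spread hN ((Fin.succ_injective N).comp he) σ

/-- The big slot is the only one with several elements, as `2 ≤ k`. It marks where slot `0` was
before the rotation, so the distribution can be recovered. -/
theorem unpin_spread_injective {k t : ℕ} (hk : 2 ≤ k) (hN : N + 1 = k + t)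
    {e e' : Fin t → Fin (N + 1)} (he : StrictMono e) (he' : StrictMono e')
    {σ : Equiv.Perm (Fin t)} (h : unpin (spread e σ) = unpin (spread e' 1)) : e = e' ∧ σ = 1 := by
  have h1 : ∀ x, spread e σ x - spread e σ 0 = spread e' 1 x - spread e' 1 0 := by
    intro x
    have := congrFun (congrArg pin h) x
    rwa [pin_unpin, pin_unpin] at this
  obtain ⟨x, hx, y, hy, hxy⟩ := Finset.one_lt_card.1
    (show 1 < (Finset.univ.filter fun x => spread e' 1 x = 0).card by
      rw [card_spread_eq_zero he'.injective]; omega)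
  simp only [Finset.mem_filter, Finset.mem_univ, true_and] at hx hy
  have hxy' : spread e σ x = spread e σ y := by
    have hx1 := h1 x
    rw [hx, ← hy, ← h1 y] at hx1
    exact sub_left_injective hx1
  have hx0 : spread e σ x = 0 := by
    by_contra hne
    have hr : ∀ z, spread e σ z ≠ 0 → z ∈ Set.range e := fun z hz => by
      by_contra hz'
      exact hz ((spread_eq_zero_iff he.injective σ z).2 hz')
    obtain ⟨a, rfl⟩ := hr x hne
    obtain ⟨b, rfl⟩ := hr y (hxy' ▸ hne)
    rw [spread_apply he.injective, spread_apply he.injective] at hxy'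
    exact hxy (congrArg e (σ.injective (Fin.succ_injective _ hxy')))
  have h0 : spread e σ 0 = spread e' 1 0 := by
    have hx1 := h1 x
    rw [hx0, hx] at hx1
    exact sub_right_injective hx1
  refine spread_eq_spread he he' (funext fun z => ?_)
  have hz := h1 z
  rw [h0] at hz
  exact sub_left_injective hz

/-- Up to sign, the rotated antisymmetrizations are dual to the standard coefficients, so these
coefficients take arbitrary values on crowded cycles. -/
theorem unpinChain_antisym_apply {k t : ℕ} (hk : 2 ≤ k) (hN : N + 1 = k + t)
    {e e' : Fin t → Fin (N + 1)} (he : StrictMono e) (he' : StrictMono e') :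
    unpinChain N t (antisym e) (unpin (spread e' 1)) =
      if e = e' then (-1 : ℂ) ^ (t * (spread e 1 0 : ℕ)) else 0 := by
  classical
  rw [antisym, map_sum, Finsupp.finsetSum_apply]
  have hterm : ∀ σ : Equiv.Perm (Fin t),
      (unpinChain N t (((Equiv.Perm.sign σ : ℤ) : ℂ) • Finsupp.single (spread e σ) 1))
        (unpin (spread e' 1)) = if e = e' ∧ σ = 1 then (-1 : ℂ) ^ (t * (spread e 1 0 : ℕ)) else 0 := by
    intro σ
    rw [map_smul, unpinChain_single, Finsupp.smul_apply, one_mul]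
    split_ifs with h
    · obtain ⟨rfl, rfl⟩ := h
      rw [Finsupp.single_eq_same]
      simp
    · rw [Finsupp.single_apply, if_neg, smul_zero]
      exact fun h' => h (unpin_spread_injective hk hN he he' h')
  rw [Finset.sum_congr rfl fun σ _ => hterm σ]
  by_cases h : e = e' <;> simp [h]

end Rotation

/-! ### Dimension counts -/

/-- The increasing families of `m` elements of `Fin N`. -/
abbrev IncFamily (m N : ℕ) : Type := {e : Fin m → Fin N // StrictMono e}

theorem card_incFamily (m N : ℕ) : Nat.card (IncFamily m N) = N.choose m := by
  let φ : IncFamily m N ≃ (Fin m ↪o Fin N) :=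
    { toFun := fun e => OrderEmbedding.ofStrictMono e.1 e.2
      invFun := fun e => ⟨e, e.strictMono⟩
      left_inv := fun _ => rfl
      right_inv := fun _ => rfl }
  rw [Nat.card_congr (φ.trans Set.powersetCard.ofFinEmbEquiv), Set.powersetCard.card,
    Nat.card_eq_fintype_card, Fintype.card_fin]

theorem finrank_incFamily (m N : ℕ) : Module.finrank ℂ (IncFamily m N → ℂ) = N.choose m := by
  classical
  rw [Module.finrank_fintype_fun_eq_card, ← Nat.card_eq_fintype_card, card_incFamily]

/-- By `hker`, `p` descends along `q` to a surjection `M : A → B` whose kernel is the image of `Z ⊓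
ker p`; rank-nullity for `M` concludes. In the application `M` is the map from crowded homology to
torus homology. -/
theorem finrank_map_inf_ker {K V A B : Type*} [Field K] [AddCommGroup V] [Module K V]
    [AddCommGroup A] [Module K A] [FiniteDimensional K A] [AddCommGroup B] [Module K B]
    (Z : Submodule K V) (q : V →ₗ[K] A) (p : V →ₗ[K] B) (hq : Z.map q = ⊤) (hp : Z.map p = ⊤)
    (hker : ∀ z ∈ Z, q z = 0 → p z = 0) :
    Module.finrank K ((Z ⊓ LinearMap.ker p).map q) + Module.finrank K B = Module.finrank K A := by
  have hq' : LinearMap.range (q.domRestrict Z) = ⊤ := by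
    rw [LinearMap.range_domRestrict, hq]
  obtain ⟨s, hs⟩ := (q.domRestrict Z).exists_rightInverse_of_surjective hq'
  have hs' : ∀ a, q (s a) = a := fun a => LinearMap.congr_fun hs a
  set M : A →ₗ[K] B := p ∘ₗ Z.subtype ∘ₗ s with hM
  have hMz : ∀ z ∈ Z, M (q z) = p z := by
    intro z hz
    have h := hker ((s (q z) : V) - z) (Z.sub_mem (s (q z)).2 hz) (by rw [map_sub, hs', sub_self])
    rw [map_sub, sub_eq_zero] at h
    exact h
  have h1 : (Z ⊓ LinearMap.ker p).map q = LinearMap.ker M := by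
    ext a
    constructor
    · rintro ⟨z, ⟨hz, hpz⟩, rfl⟩
      rw [LinearMap.mem_ker, hMz z hz]
      exact hpz
    · intro ha
      exact ⟨s a, ⟨(s a).2, ha⟩, hs' a⟩
  have h2 : LinearMap.range M = ⊤ := by
    rw [eq_top_iff, ← hp]
    rintro _ ⟨z, hz, rfl⟩
    exact ⟨q z, hMz z hz⟩
  have h3 := LinearMap.finrank_range_add_finrank_ker M
  rw [h2, finrank_top] at h3
  rw [h1, add_comm]
  exact h3

theorem finrank_map_eq_of_ker {K V W X : Type*} [Field K] [AddCommGroup V] [Module K V]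
    [AddCommGroup W] [Module K W] [AddCommGroup X] [Module K X] (Z : Submodule K V) (f : V →ₗ[K] W)
    (g : V →ₗ[K] X) (h : ∀ z ∈ Z, f z = 0 ↔ g z = 0) :
    Module.finrank K (Z.map f) = Module.finrank K (Z.map g) := by
  have hker : LinearMap.ker (f.domRestrict Z) = LinearMap.ker (g.domRestrict Z) := by
    ext z
    exact h z z.2
  rw [← LinearMap.range_domRestrict, ← LinearMap.range_domRestrict,
    ← (f.domRestrict Z).quotKerEquivRange.finrank_eq,
    ← (g.domRestrict Z).quotKerEquivRange.finrank_eq, hker]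

theorem finrank_submodule_prod {K V W : Type*} [Field K] [AddCommGroup V] [Module K V]
    [AddCommGroup W] [Module K W] [FiniteDimensional K V] [FiniteDimensional K W]
    (p : Submodule K V) (q : Submodule K W) :
    Module.finrank K (p.prod q) = Module.finrank K p + Module.finrank K q := by
  have h : p.prod q = LinearMap.range (p.subtype.prodMap q.subtype) := by
    rw [LinearMap.range_prodMap, Submodule.range_subtype, Submodule.range_subtype]
  rw [h, LinearMap.finrank_range_of_inj
    (Prod.map_injective.2 ⟨p.injective_subtype, q.injective_subtype⟩), Module.finrank_prod]

/-! ### Torus homology relative to the crowded chains -/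

section Homology

variable {N k : ℕ}

/-- The counts along all increasing families. -/
noncomputable def placings (N m : ℕ) : SlotChain (Fin N) m →ₗ[ℂ] (IncFamily m N → ℂ) :=
  LinearMap.pi fun e => placing e.1

/-- The coefficients at the standard distributions, relative to the pinned element. -/
noncomputable def standardCoeffs (N t : ℕ) :
    SlotChain (Fin N) t →ₗ[ℂ] (IncFamily t (N + 1) → ℂ) :=
  LinearMap.pi fun e => Finsupp.lapply (unpin (spread e.1 1))

/-- Cycles relative to the crowded chains. -/
noncomputable def relCycles (N k m : ℕ) : Submodule ℂ (SlotChain (Fin N) (m + 1)) :=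
  (crowdedChains N k m).comap (slotBoundary _ m)

/-- Boundaries relative to the crowded chains. -/
noncomputable def relBoundaries (N k m : ℕ) : Submodule ℂ (SlotChain (Fin N) (m + 1)) :=
  crowdedChains N k (m + 1) ⊔ LinearMap.range (slotBoundary _ (m + 1))

/-- The relative homology in degree `m + 1`, as a space of chains modulo boundaries. -/
noncomputable def relHomology (N k m : ℕ) :
    Submodule ℂ (SlotChain (Fin N) (m + 1) ⧸ relBoundaries N k m) :=
  (relCycles N k m).map (relBoundaries N k m).mkQ

theorem placings_antisym (m : ℕ) (w : IncFamily m N → ℂ) :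
    placings N m (∑ e, w e • antisym e.1) = w := by
  classical
  funext e
  rw [map_sum, Finset.sum_apply, Finset.sum_eq_single e]
  · rw [map_smul, Pi.smul_apply, placings, LinearMap.pi_apply, placing_antisym e.2 e.2, if_pos rfl,
      smul_eq_mul, mul_one]
  · intro e' _ hne
    rw [map_smul, Pi.smul_apply, placings, LinearMap.pi_apply, placing_antisym e'.2 e.2,
      if_neg fun h => hne (Subtype.ext h), smul_zero]
  · exact fun h => absurd (Finset.mem_univ _) h

theorem sum_antisym_mem_slotCycles (m : ℕ) (w : IncFamily m N → ℂ) :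
    ∑ e, w e • antisym e.1 ∈ slotCycles (Fin N) m :=
  Submodule.sum_mem _ fun e _ => Submodule.smul_mem _ _ (antisym_mem_slotCycles e.2.injective)

theorem exists_slotBoundary_eq_of_placings {m : ℕ} {c : SlotChain (Fin N) m}
    (hc : c ∈ slotCycles (Fin N) m) (h : placings N m c = 0) :
    ∃ y, slotBoundary _ m y = c :=
  exists_slotBoundary_eq N m c hc fun e he => congrFun h ⟨e, he⟩

theorem placings_slotBoundary {m : ℕ} (c : SlotChain (Fin N) (m + 1)) :
    placings N m (slotBoundary _ m c) = 0 :=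
  funext fun e => placing_slotBoundary e.1 c

theorem placings_of_degenerate {m : ℕ} {c : SlotChain (Fin N) m}
    (hc : c ∈ Finsupp.supported ℂ ℂ {g | Degenerate g}) : placings N m c = 0 :=
  funext fun e => placing_eq_zero_of_degenerate hc e.1

theorem placings_relBoundaries {m : ℕ} (h : N + 1 < k + (m + 1)) {c : SlotChain (Fin N) (m + 1)}
    (hc : c ∈ relBoundaries N k m) : placings N (m + 1) c = 0 := by
  obtain ⟨y, hy, _, ⟨z, rfl⟩, rfl⟩ := Submodule.mem_sup.1 hc
  rw [map_add, placings_slotBoundary, add_zero]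
  exact placings_of_degenerate (crowdedChains_le_degenerate h hy)

/-- A relative cycle with degenerate boundary and vanishing counts is a relative boundary. -/
theorem mem_relBoundaries {m : ℕ} (h : N + 1 < k + (m + 1)) {c : SlotChain (Fin N) (m + 1)}
    (hc : c ∈ relCycles N k m)
    (hd : slotBoundary _ m c ∈ Finsupp.supported ℂ ℂ {g | Degenerate g})
    (hp : placings N (m + 1) c = 0) : c ∈ relBoundaries N k m := by
  -- The boundary is filled by a crowded chain `y`, which is degenerate for degree reasons and does
  -- not affect the counts. Thus `c - y` is a cycle that bounds in the torus.
  obtain ⟨y, hy, hyc⟩ := exists_crowded_of_degenerate hc hd (slotBoundary_mem_slotCycles m c)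
  obtain ⟨z, hz⟩ := exists_slotBoundary_eq_of_placings (c := c - y)
    (by change slotBoundary _ m (c - y) = 0; rw [map_sub, hyc, sub_self])
    (by rw [map_sub, hp, placings_of_degenerate (crowdedChains_le_degenerate h hy), sub_zero])
  exact Submodule.mem_sup.2 ⟨y, hy, _, ⟨z, rfl⟩, by rw [hz, add_sub_cancel]⟩

theorem finrank_relHomology {X : Type*} [AddCommGroup X] [Module ℂ X] {m : ℕ}
    (f : SlotChain (Fin N) (m + 1) →ₗ[ℂ] X)
    (hf : ∀ c ∈ relCycles N k m, f c = 0 ↔ c ∈ relBoundaries N k m) :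
    Module.finrank ℂ (relHomology N k m) = Module.finrank ℂ ((relCycles N k m).map f) :=
  finrank_map_eq_of_ker _ _ _ fun c hc => by
    rw [hf c hc, Submodule.mkQ_apply, Submodule.Quotient.mk_eq_zero]

/-- Crowded chains are degenerate in degrees `m` and `m + 1`, so crowded homology vanishes there and
the relative homology is that of the torus. -/
theorem finrank_relHomology_of_lt {m : ℕ} (h : N + 1 < k + m) :
    Module.finrank ℂ (relHomology N k m) = N.choose (m + 1) := by
  rw [finrank_relHomology (placings N (m + 1)) fun c hc =>
    ⟨mem_relBoundaries (by omega) hc (crowdedChains_le_degenerate h hc),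
      placings_relBoundaries (by omega)⟩]
  have htop : (relCycles N k m).map (placings N (m + 1)) = ⊤ := by
    rw [eq_top_iff]
    intro w _
    refine ⟨_, ?_, placings_antisym _ w⟩
    change slotBoundary _ m _ ∈ crowdedChains N k m
    rw [show slotBoundary _ m _ = 0 from sum_antisym_mem_slotCycles _ w]
    exact Submodule.zero_mem _
  rw [htop, finrank_top, finrank_incFamily]

theorem not_degenerate_unpin_spread {t : ℕ} (hk : 1 ≤ k) (hN : N + 1 = k + t)
    {e : Fin t → Fin (N + 1)} (he : StrictMono e) : ¬ Degenerate (unpin (spread e 1)) := by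
  rintro ⟨j, hj, h⟩
  have hsurj : Function.Surjective (spread e 1) := by
    intro i
    cases i using Fin.cases with
    | zero =>
      have hc := card_spread_eq_zero he.injective 1
      obtain ⟨x, hx⟩ := Finset.card_pos.1 (show 0 <
        (Finset.univ.filter fun x => spread e 1 x = 0).card by omega)
      exact ⟨x, by simpa using hx⟩
    | succ a => exact ⟨e a, spread_apply he.injective 1 a⟩
  obtain ⟨x, hx⟩ := hsurj (j + spread e 1 0)
  cases x using Fin.cases with
  | zero => exact hj (by simpa using hx)
  | succ x => exact h x (by rw [unpin, hx, add_sub_cancel_right])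

theorem standardCoeffs_of_degenerate {t : ℕ} (hk : 1 ≤ k) (hN : N + 1 = k + t)
    {c : SlotChain (Fin N) t} (hc : c ∈ Finsupp.supported ℂ ℂ {g | Degenerate g}) :
    standardCoeffs N t c = 0 :=
  funext fun e => (Finsupp.mem_supported' ℂ _).1 hc _ (not_degenerate_unpin_spread hk hN e.2)

/-- The crowded cycles. -/
noncomputable def crowdedCycles (N k t : ℕ) : Submodule ℂ (SlotChain (Fin N) t) :=
  crowdedChains N k t ⊓ slotCycles (Fin N) t

theorem map_standardCoeffs_crowdedCycles {t : ℕ} (hk : 2 ≤ k) (hN : N + 1 = k + t) :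
    (crowdedCycles N k t).map (standardCoeffs N t) = ⊤ := by
  classical
  rw [eq_top_iff]
  intro w _
  refine ⟨∑ e : IncFamily t (N + 1),
    (w e * (-1 : ℂ) ^ (t * (spread e.1 1 0 : ℕ))) • unpinChain N t (antisym e.1),
    ⟨?_, ?_⟩, ?_⟩
  · exact Submodule.sum_mem _ fun e _ =>
      Submodule.smul_mem _ _ (unpinChain_antisym_mem hN e.2.injective)
  · exact Submodule.sum_mem _ fun e _ => Submodule.smul_mem _ _
      (unpinChain_mem_slotCycles (antisym_mem_slotCycles e.2.injective))
  · funext e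
    rw [map_sum, Finset.sum_apply, Finset.sum_eq_single e]
    · rw [map_smul, Pi.smul_apply, standardCoeffs, LinearMap.pi_apply, Finsupp.lapply_apply,
        unpinChain_antisym_apply hk hN e.2 e.2, if_pos rfl, smul_eq_mul, mul_assoc, ← pow_add,
        Even.neg_one_pow ⟨_, rfl⟩, mul_one]
    · intro e' _ hne
      rw [map_smul, Pi.smul_apply, standardCoeffs, LinearMap.pi_apply, Finsupp.lapply_apply,
        unpinChain_antisym_apply hk hN e'.2 e.2, if_neg fun h => hne (Subtype.ext h), smul_zero]
    · exact fun h => absurd (Finset.mem_univ _) h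

theorem map_placings_crowdedCycles {t : ℕ} (hN : N + 1 = k + t) :
    (crowdedCycles N k t).map (placings N t) = ⊤ := by
  rw [eq_top_iff]
  intro w _
  exact ⟨_, ⟨Submodule.sum_mem _ fun e _ =>
      Submodule.smul_mem _ _ (antisym_mem_crowdedChains hN e.2.injective),
    sum_antisym_mem_slotCycles t w⟩, placings_antisym t w⟩

/-- In the long exact sequence the crowded homology vanishes in degree `t + 1`. So the relative
homology is an extension of the kernel of the surjection from crowded to torus homology in degree
`t` by the torus homology in degree `t + 1`. The counts and the standard coefficients of the
boundary give coordinates on the two pieces. -/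
theorem finrank_relHomology_of_eq {t : ℕ} (hk : 3 ≤ k) (hN : N + 1 = k + t) :
    Module.finrank ℂ (relHomology N k t) + N.choose t =
      N.choose (t + 1) + (N + 1).choose t := by
  set Z := crowdedCycles N k t with hZ
  set V := (Z ⊓ LinearMap.ker (placings N t)).map (standardCoeffs N t) with hV
  have hdeg : ∀ l ∈ Z, standardCoeffs N t l = 0 →
      l ∈ Finsupp.supported ℂ ℂ {g | Degenerate g} := fun l hl h =>
    mem_degenerate_of_coeff hk hN hl.1 hl.2 fun e he => congrFun h ⟨e, he⟩
  have hVdim := finrank_map_inf_ker Z (standardCoeffs N t) (placings N t)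
    (map_standardCoeffs_crowdedCycles (by omega) hN) (map_placings_crowdedCycles hN)
    fun l hl h => placings_of_degenerate (hdeg l hl h)
  rw [finrank_incFamily, finrank_incFamily] at hVdim
  have hbd : ∀ c ∈ relCycles N k t, slotBoundary _ t c ∈ Z := fun c hc =>
    ⟨hc, slotBoundary_mem_slotCycles t c⟩
  rw [finrank_relHomology
    ((placings N (t + 1)).prod (standardCoeffs N t ∘ₗ slotBoundary _ t)) fun c hc => ?_]
  · have hmap : (relCycles N k t).map
        ((placings N (t + 1)).prod (standardCoeffs N t ∘ₗ slotBoundary _ t)) =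
          (⊤ : Submodule ℂ (IncFamily (t + 1) N → ℂ)).prod V := by
      ext ⟨w, v⟩
      constructor
      · rintro ⟨c, hc, hcw⟩
        obtain ⟨rfl, rfl⟩ := Prod.ext_iff.1 hcw
        exact ⟨trivial, _, ⟨hbd c hc, placings_slotBoundary c⟩, rfl⟩
      · rintro ⟨-, l, ⟨hl, hpl⟩, hlv⟩
        obtain ⟨c₀, hc₀⟩ := exists_slotBoundary_eq_of_placings hl.2 hpl
        -- Adding the cycle `ω` corrects the counts to `w` without changing the boundary.
        set ω := ∑ e, (w - placings N (t + 1) c₀) e • antisym e.1 with hω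
        have hωb : slotBoundary _ t ω = 0 := sum_antisym_mem_slotCycles (t + 1) _
        have hb : slotBoundary _ t (c₀ + ω) = l := by rw [map_add, hωb, add_zero, hc₀]
        refine ⟨c₀ + ω, ?_, Prod.ext ?_ ?_⟩
        · change slotBoundary _ t (c₀ + ω) ∈ crowdedChains N k t
          rw [hb]
          exact hl.1
        · change placings N (t + 1) (c₀ + ω) = w
          rw [map_add, hω, placings_antisym, add_sub_cancel]
        · change standardCoeffs N t (slotBoundary _ t (c₀ + ω)) = v
          rw [hb]
          exact hlv
    rw [hmap, finrank_submodule_prod, finrank_top, finrank_incFamily, add_assoc, hVdim]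
  · constructor
    · intro h
      obtain ⟨h1, h2⟩ := Prod.ext_iff.1 h
      exact mem_relBoundaries (by omega) hc (hdeg _ (hbd c hc) h2) h1
    · intro h
      refine Prod.ext (placings_relBoundaries (by omega) h) ?_
      change standardCoeffs N t (slotBoundary _ t c) = 0
      obtain ⟨y, hy, _, ⟨z, rfl⟩, rfl⟩ := Submodule.mem_sup.1 h
      rw [map_add, slotBoundary_slotBoundary, add_zero]
      exact standardCoeffs_of_degenerate (by omega) hN
        (slotBoundary_mem_degenerate (crowdedChains_le_degenerate (by omega) hy))

end Homology

/-! ### Tensors of monomials as distributions -/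

theorem faceFun_eq_prod {A : Type*} [CommRing A] {m : ℕ} (i : Fin (m + 2)) (a : Fin (m + 2) → A)
    (j : Fin (m + 1)) :
    faceFun i a j = ∏ x ∈ Finset.univ.filter fun x => merge m i x = j, a x := by
  have hj := j.isLt
  by_cases hi : i = Fin.last (m + 1)
  · subst hi
    by_cases hj0 : j = 0
    · subst hj0
      have hs : (Finset.univ.filter fun x => merge m (Fin.last (m + 1) : Fin (m + 2)) x = 0) =
          {Fin.last (m + 1), 0} := by
        ext x
        have := x.isLt
        simp only [Finset.mem_filter, Finset.mem_univ, true_and, Finset.mem_insert,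
          Finset.mem_singleton, Fin.ext_iff, merge_val, Fin.val_last, Fin.val_zero]
        split_ifs <;> omega
      rw [hs, Finset.prod_pair Fin.last_pos.ne']
      simp [faceFun]
    · have hs : (Finset.univ.filter fun x => merge m (Fin.last (m + 1) : Fin (m + 2)) x = j) =
          {j.castSucc} := by
        ext x
        have := x.isLt
        have : (j : ℕ) ≠ 0 := fun h => hj0 (Fin.ext h)
        simp only [Finset.mem_filter, Finset.mem_univ, true_and,
          Finset.mem_singleton, Fin.ext_iff, merge_val, Fin.val_last, Fin.val_castSucc]
        split_ifs <;> omega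
      rw [hs, Finset.prod_singleton]
      simp [faceFun, hj0]
  · have hi' : (i : ℕ) < m + 1 := Fin.val_lt_last hi
    simp only [faceFun, hi, if_false, Fin.contractNth]
    split_ifs with h1 h2
    · have hs : (Finset.univ.filter fun x => merge m i x = j) = {j.castSucc} := by
        ext x
        have := x.isLt
        simp only [Finset.mem_filter, Finset.mem_univ, true_and,
          Finset.mem_singleton, Fin.ext_iff, merge_val, Fin.val_castSucc]
        split_ifs <;> omega
      rw [hs, Finset.prod_singleton]
    · have hs : (Finset.univ.filter fun x => merge m i x = j) = {j.castSucc, j.succ} := by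
        ext x
        have := x.isLt
        simp only [Finset.mem_filter, Finset.mem_univ, true_and, Finset.mem_insert,
          Finset.mem_singleton, Fin.ext_iff, merge_val, Fin.val_castSucc, Fin.val_succ]
        split_ifs <;> omega
      rw [hs, Finset.prod_pair (by simp [Fin.ext_iff])]
    · have hs : (Finset.univ.filter fun x => merge m i x = j) = {j.succ} := by
        ext x
        have := x.isLt
        simp only [Finset.mem_filter, Finset.mem_univ, true_and,
          Finset.mem_singleton, Fin.ext_iff, merge_val, Fin.val_succ]
        split_ifs <;> omega
      rw [hs, Finset.prod_singleton]

/-- The exponents of the monomials in the slots of a distribution. -/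
noncomputable def slotExponent {n m : ℕ} (f : Fin n → Fin (m + 1)) (i : Fin (m + 1)) :
    Fin n →₀ ℕ :=
  Finsupp.equivFunOnFinite.symm fun v => if f v = i then 1 else 0

theorem slotExponent_apply {n m : ℕ} (f : Fin n → Fin (m + 1)) (i : Fin (m + 1)) (v : Fin n) :
    slotExponent f i v = if f v = i then 1 else 0 := rfl

theorem slotExponent_injective {n m : ℕ} {f g : Fin n → Fin (m + 1)}
    (h : slotExponent f = slotExponent g) : f = g := by
  funext v
  have h1 := DFunLike.congr_fun (congrFun h (f v)) v
  rw [slotExponent_apply, slotExponent_apply, if_pos rfl] at h1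
  by_contra hne
  rw [if_neg fun h => hne h.symm] at h1
  exact one_ne_zero h1

theorem support_slotExponent {n m : ℕ} (f : Fin n → Fin (m + 1)) (i : Fin (m + 1)) :
    (slotExponent f i).support = Finset.univ.filter fun v => f v = i := by
  ext v
  simp [slotExponent_apply]

theorem sum_slotExponent {n m : ℕ} (f : Fin n → Fin (m + 1)) (v : Fin n) :
    ∑ i, slotExponent f i v = 1 := by
  simp [slotExponent_apply]

theorem exists_eq_slotExponent {n m : ℕ} {d : Fin (m + 1) → Fin n →₀ ℕ}
    (hd : ∀ v, ∑ i, d i v = 1) : ∃ f, d = slotExponent f := by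
  have h : ∀ v, ∃ i, d i v = 1 ∧ ∀ j, j ≠ i → d j v = 0 := by
    intro v
    obtain ⟨i, -, hi⟩ := Finset.exists_ne_zero_of_sum_ne_zero (by rw [hd v]; exact one_ne_zero)
    have h1 := Finset.add_sum_erase Finset.univ (fun i => d i v) (Finset.mem_univ i)
    rw [hd v] at h1
    refine ⟨i, by omega, fun j hj => ?_⟩
    exact Finset.sum_eq_zero_iff.1 (show ∑ j ∈ Finset.univ.erase i, d j v = 0 by omega) j
      (by simp [hj])
  choose f hf1 hf2 using h
  refine ⟨f, funext fun i => Finsupp.ext fun v => ?_⟩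
  rw [slotExponent_apply]
  split_ifs with h
  · rw [← h, hf1]
  · exact hf2 v i fun h' => h h'.symm

section Ring

variable {n k : ℕ}

/-- The tensor of the classes of the monomials with exponents `d`. -/
noncomputable def monomialTensor (n k : ℕ) {m : ℕ} (d : Fin (m + 1) → Fin n →₀ ℕ) :
    Chain ℂ (EdgeRing (completeUniform n k)) m :=
  PiTensorProduct.tprod ℂ fun i =>
    Ideal.Quotient.mk (edgeIdeal (completeUniform n k)) (MvPolynomial.monomial (d i) (1 : ℂ))

theorem chain_hom_ext {m : ℕ} {V : Type*} [AddCommGroup V] [Module ℂ V]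
    {f g : Chain ℂ (EdgeRing (completeUniform n k)) m →ₗ[ℂ] V}
    (h : ∀ d, f (monomialTensor n k d) = g (monomialTensor n k d)) : f = g := by
  refine PiTensorProduct.ext (MultilinearMap.ext fun a => ?_)
  choose p hp using fun i => Ideal.Quotient.mk_surjective (a i)
  let q : MvPolynomial (Fin n) ℂ →ₗ[ℂ] EdgeRing (completeUniform n k) :=
    (Ideal.Quotient.mkₐ ℂ (edgeIdeal (completeUniform n k))).toLinearMap
  have key : (f.compMultilinearMap (PiTensorProduct.tprod ℂ)).compLinearMap (fun _ => q) =
      (g.compMultilinearMap (PiTensorProduct.tprod ℂ)).compLinearMap (fun _ => q) := by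
    refine Module.Basis.ext_multilinear (fun _ => MvPolynomial.basisMonomials (Fin n) ℂ)
      fun d => ?_
    have := h d
    simp only [MultilinearMap.compLinearMap_apply, MvPolynomial.coe_basisMonomials]
    exact this
  obtain rfl : a = fun i => q (p i) := funext fun i => (hp i).symm
  exact congrArg (fun φ => φ p) key

theorem face_monomialTensor {m : ℕ} (i : Fin (m + 2)) (d : Fin (m + 2) → Fin n →₀ ℕ) :
    face ℂ _ m i (monomialTensor n k d) =
      monomialTensor n k fun j => ∑ x ∈ Finset.univ.filter fun x => merge m i x = j, d x := by
  rw [monomialTensor, face_tprod, monomialTensor]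
  congr 1
  funext j
  rw [faceFun_eq_prod, ← map_prod, MvPolynomial.monomial_sum_one]

theorem cyclicT_monomialTensor {m : ℕ} (d : Fin (m + 1) → Fin n →₀ ℕ) :
    cyclicT ℂ _ m (monomialTensor n k d) =
      (-1 : ℂ) ^ m • monomialTensor n k fun j => d (j - 1) := by
  rw [monomialTensor, cyclicT_tprod]
  rfl

theorem sum_slotExponent_merge {m : ℕ} (i : ℕ) (f : Fin n → Fin (m + 2)) (j : Fin (m + 1)) :
    ∑ x ∈ Finset.univ.filter (fun x => merge m i x = j), slotExponent f x =
      slotExponent (merge m i ∘ f) j := by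
  ext v
  rw [Finsupp.finsetSum_apply]
  simp only [slotExponent_apply, Finset.sum_ite_eq, Finset.mem_filter, Finset.mem_univ, true_and,
    Function.comp_apply]

theorem hochschildB_slotExponent {m : ℕ} (f : Fin n → Fin (m + 2)) :
    hochschildB ℂ _ m (monomialTensor n k (slotExponent f)) =
      ∑ i ∈ Finset.range (m + 2),
        (-1 : ℂ) ^ i • monomialTensor n k (slotExponent (merge m i ∘ f)) := by
  rw [hochschildB, LinearMap.sum_apply, Finset.sum_range]
  refine Finset.sum_congr rfl fun i _ => ?_
  rw [LinearMap.smul_apply, face_monomialTensor]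
  congr 2
  funext j
  exact sum_slotExponent_merge i f j

theorem cyclicT_slotExponent {m : ℕ} (f : Fin n → Fin (m + 1)) :
    cyclicT ℂ _ m (monomialTensor n k (slotExponent f)) =
      (-1 : ℂ) ^ m • monomialTensor n k (slotExponent fun v => f v + 1) := by
  rw [cyclicT_monomialTensor]
  congr 2
  funext j
  ext v
  simp only [slotExponent_apply, eq_sub_iff_add_eq]

theorem monomial_slotExponent {m : ℕ} (f : Fin n → Fin (m + 1)) (i : Fin (m + 1)) :
    MvPolynomial.monomial (slotExponent f i) (1 : ℂ) =
      ∏ v ∈ Finset.univ.filter fun v => f v = i, MvPolynomial.X v := by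
  have h : slotExponent f i = ∑ v ∈ Finset.univ.filter fun v => f v = i, Finsupp.single v 1 := by
    ext w
    rw [Finsupp.finsetSum_apply, slotExponent_apply]
    simp [Finsupp.single_apply]
  rw [h, MvPolynomial.monomial_sum_one]
  rfl

theorem monomialTensor_of_crowded {m : ℕ} {f : Fin n → Fin (m + 1)} (hf : Crowded k f) :
    monomialTensor n k (slotExponent f) = 0 := by
  classical
  obtain ⟨i, hi⟩ := hf
  obtain ⟨e, he, hek⟩ := Finset.exists_subset_card_eq hi
  refine MultilinearMap.map_coord_zero _ i ?_
  rw [Ideal.Quotient.eq_zero_iff_mem, monomial_slotExponent, ← Finset.prod_sdiff he]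
  refine Ideal.mul_mem_left _ _ (Ideal.subset_span ⟨e, ?_, rfl⟩)
  change (e : Set (Fin n)).ncard = k
  rw [Set.ncard_coe_finset, hek]

/-- Each monomial occurring in an element of the ideal is divisible by an edge monomial and thus
involves at least `k` variables. -/
theorem coeff_of_mem_edgeIdeal {p : MvPolynomial (Fin n) ℂ}
    (hp : p ∈ edgeIdeal (completeUniform n k)) {d : Fin n →₀ ℕ} (hd : d.support.card < k) :
    p.coeff d = 0 := by
  classical
  induction hp using Submodule.span_induction generalizing d with
  | mem p hp =>
    obtain ⟨e, he, rfl⟩ := hp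
    have hek : e.card = k := by
      rw [← Set.ncard_coe_finset]
      exact he
    have h : (∏ v ∈ e, MvPolynomial.X v : MvPolynomial (Fin n) ℂ) =
        MvPolynomial.monomial (∑ v ∈ e, Finsupp.single v 1) 1 := by
      rw [MvPolynomial.monomial_sum_one]
      rfl
    rw [h, MvPolynomial.coeff_monomial, if_neg]
    rintro rfl
    refine absurd hd (not_lt.2 (hek ▸ Finset.card_le_card fun v hv => ?_))
    rw [Finsupp.mem_support_iff, Finsupp.finsetSum_apply]
    simp [Finsupp.single_apply, hv]
  | zero => exact MvPolynomial.coeff_zero d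
  | add p q _ _ hp hq => rw [MvPolynomial.coeff_add, hp hd, hq hd, add_zero]
  | smul a p _ hp =>
    rw [smul_eq_mul, MvPolynomial.coeff_mul]
    refine Finset.sum_eq_zero fun x hx => ?_
    rw [Finset.HasAntidiagonal.mem_antidiagonal] at hx
    rw [hp (lt_of_le_of_lt (Finset.card_le_card (Finsupp.support_mono ?_)) hd), mul_zero]
    rw [← hx]
    exact le_add_self

theorem exists_quotientCoeff (n k : ℕ) (d : Fin n →₀ ℕ) :
    ∃ κ : EdgeRing (completeUniform n k) →ₗ[ℂ] ℂ, ∀ p : MvPolynomial (Fin n) ℂ,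
      κ (Ideal.Quotient.mk _ p) = if d.support.card < k then p.coeff d else 0 := by
  split_ifs with hd
  · let q : MvPolynomial (Fin n) ℂ →ₗ[ℂ] EdgeRing (completeUniform n k) :=
      (Ideal.Quotient.mkₐ ℂ (edgeIdeal (completeUniform n k))).toLinearMap
    obtain ⟨s, hs⟩ := q.exists_rightInverse_of_surjective
      (LinearMap.range_eq_top.2 Ideal.Quotient.mk_surjective)
    refine ⟨MvPolynomial.lcoeff ℂ d ∘ₗ s, fun p => ?_⟩
    have h1 : q (s (q p)) = q p := LinearMap.congr_fun hs (q p)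
    have h2 : s (q p) - p ∈ edgeIdeal (completeUniform n k) := Ideal.Quotient.eq.1 h1
    have h3 := coeff_of_mem_edgeIdeal h2 hd
    rw [MvPolynomial.coeff_sub, sub_eq_zero] at h3
    exact h3
  · exact ⟨0, fun p => rfl⟩

/-- The coefficient at `x ^ d` of an element of the quotient ring, for `d` with fewer than `k`
variables; zero for other `d`. -/
noncomputable def quotientCoeff (n k : ℕ) (d : Fin n →₀ ℕ) :
    EdgeRing (completeUniform n k) →ₗ[ℂ] ℂ :=
  (exists_quotientCoeff n k d).choose

theorem quotientCoeff_mk (d : Fin n →₀ ℕ) (p : MvPolynomial (Fin n) ℂ) :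
    quotientCoeff n k d (Ideal.Quotient.mk _ p) =
      if d.support.card < k then p.coeff d else 0 :=
  (exists_quotientCoeff n k d).choose_spec p

/-- The multilinear part of a chain. -/
noncomputable def toSlots (n k m : ℕ) :
    Chain ℂ (EdgeRing (completeUniform n k)) m →ₗ[ℂ] SlotChain (Fin n) m :=
  (Finsupp.linearEquivFunOnFinite ℂ ℂ (Fin n → Fin (m + 1))).symm.toLinearMap ∘ₗ
    LinearMap.pi fun f => PiTensorProduct.lift
      ((MultilinearMap.mkPiAlgebra ℂ (Fin (m + 1)) ℂ).compLinearMap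
        fun i => quotientCoeff n k (slotExponent f i))

theorem toSlots_monomialTensor_apply {m : ℕ} (d : Fin (m + 1) → Fin n →₀ ℕ)
    (f : Fin n → Fin (m + 1)) :
    toSlots n k m (monomialTensor n k d) f =
      ∏ i, if (slotExponent f i).support.card < k then
        (if d i = slotExponent f i then (1 : ℂ) else 0) else 0 := by
  change PiTensorProduct.lift ((MultilinearMap.mkPiAlgebra ℂ (Fin (m + 1)) ℂ).compLinearMap
        fun i => quotientCoeff n k (slotExponent f i)) (monomialTensor n k d) = _
  rw [monomialTensor, PiTensorProduct.lift.tprod, MultilinearMap.compLinearMap_apply,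
    MultilinearMap.mkPiAlgebra_apply]
  refine Finset.prod_congr rfl fun i _ => ?_
  rw [quotientCoeff_mk, MvPolynomial.coeff_monomial]

theorem toSlots_eq_zero {m : ℕ} {d : Fin (m + 1) → Fin n →₀ ℕ} (hd : ¬ ∀ v, ∑ i, d i v = 1) :
    toSlots n k m (monomialTensor n k d) = 0 := by
  refine Finsupp.ext fun f => ?_
  rw [toSlots_monomialTensor_apply, Finsupp.zero_apply, Finset.prod_eq_zero_iff]
  by_contra h
  push Not at h
  refine hd ?_
  have : d = slotExponent f := by
    funext i
    by_contra hne
    apply h i (Finset.mem_univ _)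
    rw [if_neg hne, ite_self]
  rw [this]
  exact sum_slotExponent f

theorem toSlots_slotExponent_of_not_crowded {m : ℕ} {f : Fin n → Fin (m + 1)}
    (hf : ¬ Crowded k f) :
    toSlots n k m (monomialTensor n k (slotExponent f)) = Finsupp.single f 1 := by
  classical
  refine Finsupp.ext fun g => ?_
  rw [toSlots_monomialTensor_apply, Finsupp.single_apply]
  split_ifs with h
  · subst h
    refine Finset.prod_eq_one fun i _ => ?_
    rw [if_pos rfl, if_pos]
    rw [support_slotExponent]
    by_contra h
    exact hf ⟨i, not_lt.1 h⟩
  · rw [Finset.prod_eq_zero_iff]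
    by_contra h'
    push Not at h'
    refine h (slotExponent_injective (funext fun i => ?_))
    by_contra hne
    apply h' i (Finset.mem_univ _)
    rw [if_neg hne, ite_self]

end Ring

/-! ### Maps out of the Connes complex -/

section Connes

variable (R A : Type*) [CommRing R] [Ring A] [Algebra R A]

/-- The class of a chain in the Connes complex. -/
noncomputable def cyclicMk (m : ℕ) : Chain R A m →ₗ[R] CyclicChain R A m :=
  (cyclicRelations R A m).mkQ

theorem cyclicMk_surjective {m : ℕ} : Function.Surjective (cyclicMk R A m) :=
  Submodule.mkQ_surjective _

variable {R A}

theorem cyclicBoundary_mk {m : ℕ} (x : Chain R A (m + 1)) :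
    cyclicBoundary R A m (cyclicMk R A (m + 1) x) = cyclicMk R A m (hochschildB R A m x) := rfl

theorem cyclicMk_cyclicT {m : ℕ} (x : Chain R A m) :
    cyclicMk R A m (cyclicT R A m x) = cyclicMk R A m x := by
  rw [eq_comm, ← sub_eq_zero, ← map_sub, cyclicMk, Submodule.mkQ_apply,
    Submodule.Quotient.mk_eq_zero]
  exact ⟨x, rfl⟩

/-- The map on the Connes complex induced by a map that is invariant under the cyclic operator. -/
noncomputable def cyclicLift {V : Type*} [AddCommGroup V] [Module R V] {m : ℕ}
    (f : Chain R A m →ₗ[R] V) (hf : f ∘ₗ (LinearMap.id - cyclicT R A m) = 0) :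
    CyclicChain R A m →ₗ[R] V :=
  Submodule.liftQ _ f (by
    rintro _ ⟨x, rfl⟩
    exact LinearMap.congr_fun hf x)

theorem cyclicLift_mk {V : Type*} [AddCommGroup V] [Module R V] {m : ℕ}
    (f : Chain R A m →ₗ[R] V) (hf : f ∘ₗ (LinearMap.id - cyclicT R A m) = 0) (x : Chain R A m) :
    cyclicLift f hf (cyclicMk R A m x) = f x := rfl

end Connes

/-! ### Comparing the Connes complex with the relative complex -/

section Transfer

variable {N k : ℕ}

/-- The multilinear part of a chain, rotated so that the first variable is in slot `0`, modulo
crowded chains. -/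
noncomputable def chainToSlots (N k m : ℕ) :
    Chain ℂ (EdgeRing (completeUniform (N + 1) k)) m →ₗ[ℂ]
      SlotChain (Fin N) m ⧸ crowdedChains N k m :=
  (crowdedChains N k m).mkQ ∘ₗ unpinChain N m ∘ₗ toSlots (N + 1) k m

theorem chainToSlots_eq_zero {m : ℕ} {d : Fin (m + 1) → Fin (N + 1) →₀ ℕ}
    (hd : ¬ ∀ v, ∑ i, d i v = 1) : chainToSlots N k m (monomialTensor (N + 1) k d) = 0 := by
  rw [chainToSlots, LinearMap.comp_apply, LinearMap.comp_apply, toSlots_eq_zero hd, map_zero,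
    map_zero]

theorem chainToSlots_slotExponent {m : ℕ} (f : Fin (N + 1) → Fin (m + 1)) :
    chainToSlots N k m (monomialTensor (N + 1) k (slotExponent f)) =
      (crowdedChains N k m).mkQ (unpinChain N m (Finsupp.single f 1)) := by
  by_cases hf : Crowded k f
  · rw [monomialTensor_of_crowded hf, map_zero, eq_comm, Submodule.mkQ_apply,
      Submodule.Quotient.mk_eq_zero, unpinChain_single]
    refine Finsupp.single_mem_supported ℂ _ ?_
    change Crowded k (pin (unpin f))
    rw [pin_unpin]
    exact hf.comp fun x => x - f 0
  · rw [chainToSlots, LinearMap.comp_apply, LinearMap.comp_apply,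
      toSlots_slotExponent_of_not_crowded hf]

theorem chainToSlots_cyclicT (m : ℕ) :
    chainToSlots N k m ∘ₗ (LinearMap.id - cyclicT ℂ _ m) = 0 := by
  refine chain_hom_ext fun d => ?_
  rw [LinearMap.comp_apply, LinearMap.sub_apply, LinearMap.id_apply, map_sub,
    LinearMap.zero_apply]
  by_cases hd : ∀ v, ∑ i, d i v = 1
  · obtain ⟨f, rfl⟩ := exists_eq_slotExponent hd
    rw [cyclicT_slotExponent, map_smul, chainToSlots_slotExponent, chainToSlots_slotExponent,
      unpinChain_rotate, map_smul, smul_smul, ← pow_add, Even.neg_one_pow ⟨m, rfl⟩, one_smul,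
      sub_self]
  · rw [cyclicT_monomialTensor, map_smul, chainToSlots_eq_zero hd, chainToSlots_eq_zero, smul_zero,
      sub_zero]
    intro h
    exact hd fun v =>
      (Equiv.sum_comp (Equiv.subRight (1 : Fin (m + 1))) fun i => d i v).symm.trans (h v)

/-- The differential on chains modulo crowded chains. -/
noncomputable def relBoundaryMap (N k m : ℕ) :
    (SlotChain (Fin N) (m + 1) ⧸ crowdedChains N k (m + 1)) →ₗ[ℂ]
      SlotChain (Fin N) m ⧸ crowdedChains N k m :=
  Submodule.mapQ _ _ (slotBoundary _ m) fun _ hc => slotBoundary_mem_crowdedChains hc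

theorem relBoundaryMap_mkQ {m : ℕ} (c : SlotChain (Fin N) (m + 1)) :
    relBoundaryMap N k m ((crowdedChains N k (m + 1)).mkQ c) =
      (crowdedChains N k m).mkQ (slotBoundary _ m c) := rfl

theorem chainToSlots_hochschildB (m : ℕ) :
    chainToSlots N k m ∘ₗ hochschildB ℂ _ m =
      relBoundaryMap N k m ∘ₗ chainToSlots N k (m + 1) := by
  refine chain_hom_ext fun d => ?_
  rw [LinearMap.comp_apply, LinearMap.comp_apply]
  by_cases hd : ∀ v, ∑ i, d i v = 1
  · obtain ⟨f, rfl⟩ := exists_eq_slotExponent hd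
    rw [hochschildB_slotExponent, chainToSlots_slotExponent, relBoundaryMap_mkQ,
      slotBoundary_unpinChain, slotBoundary_single, map_sum, map_sum, map_sum]
    refine Finset.sum_congr rfl fun i _ => ?_
    rw [map_smul, chainToSlots_slotExponent, ← map_smul, ← map_smul, Finsupp.smul_single,
      smul_eq_mul, mul_one]
  · rw [chainToSlots_eq_zero hd, map_zero, hochschildB, LinearMap.sum_apply, map_sum]
    refine Finset.sum_eq_zero fun i _ => ?_
    rw [LinearMap.smul_apply, face_monomialTensor, map_smul, chainToSlots_eq_zero, smul_zero]
    intro h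
    refine hd fun v => Eq.trans ?_ (h v)
    simp only [Finsupp.finsetSum_apply]
    exact (Finset.sum_fiberwise Finset.univ (merge m i) fun x => d x v).symm

/-- The map induced by `chainToSlots` on the Connes complex. -/
noncomputable def cyclicToSlots (N k m : ℕ) :
    CyclicChain ℂ (EdgeRing (completeUniform (N + 1) k)) m →ₗ[ℂ]
      SlotChain (Fin N) m ⧸ crowdedChains N k m :=
  cyclicLift (chainToSlots N k m) (chainToSlots_cyclicT m)

theorem cyclicToSlots_cyclicBoundary {m : ℕ}
    (x : CyclicChain ℂ (EdgeRing (completeUniform (N + 1) k)) (m + 1)) :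
    cyclicToSlots N k m (cyclicBoundary ℂ (EdgeRing (completeUniform (N + 1) k)) m x) =
      relBoundaryMap N k m (cyclicToSlots N k (m + 1) x) := by
  obtain ⟨x, rfl⟩ := cyclicMk_surjective ℂ (EdgeRing (completeUniform (N + 1) k)) x
  rw [cyclicBoundary_mk, cyclicToSlots, cyclicToSlots, cyclicLift_mk, cyclicLift_mk]
  exact LinearMap.congr_fun (chainToSlots_hochschildB m) x

/-- The cyclic chain of a distribution. -/
noncomputable def slotsToCyclic (N k m : ℕ) : SlotChain (Fin N) m →ₗ[ℂ]
    CyclicChain ℂ (EdgeRing (completeUniform (N + 1) k)) m :=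
  Finsupp.linearCombination ℂ fun g =>
    cyclicMk ℂ (EdgeRing (completeUniform (N + 1) k)) m (monomialTensor (N + 1) k (slotExponent (pin g)))

theorem slotsToCyclic_single {m : ℕ} (g : Fin N → Fin (m + 1)) (r : ℂ) :
    slotsToCyclic N k m (Finsupp.single g r) =
      r • cyclicMk ℂ (EdgeRing (completeUniform (N + 1) k)) m (monomialTensor (N + 1) k (slotExponent (pin g))) :=
  Finsupp.linearCombination_single ℂ r g

/-- Together with `slotsToCyclic_of_crowded` this shows that the kernel of `slotsToCyclic` is
exactly the crowded chains. -/
theorem cyclicToSlots_slotsToCyclic {m : ℕ} (c : SlotChain (Fin N) m) :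
    cyclicToSlots N k m (slotsToCyclic N k m c) = (crowdedChains N k m).mkQ c := by
  suffices h : cyclicToSlots N k m ∘ₗ slotsToCyclic N k m = (crowdedChains N k m).mkQ from
    LinearMap.congr_fun h c
  refine SlotChain.hom_ext fun g => ?_
  rw [LinearMap.comp_apply, slotsToCyclic_single, one_smul, cyclicToSlots, cyclicLift_mk,
    chainToSlots_slotExponent, unpinChain_single_pin]

theorem cyclicBoundary_slotsToCyclic {m : ℕ} (c : SlotChain (Fin N) (m + 1)) :
    cyclicBoundary ℂ (EdgeRing (completeUniform (N + 1) k)) m (slotsToCyclic N k (m + 1) c) =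
      slotsToCyclic N k m (slotBoundary _ m c) := by
  suffices h : cyclicBoundary ℂ (EdgeRing (completeUniform (N + 1) k)) m ∘ₗ slotsToCyclic N k (m + 1) =
      slotsToCyclic N k m ∘ₗ slotBoundary _ m from LinearMap.congr_fun h c
  refine SlotChain.hom_ext fun g => ?_
  rw [LinearMap.comp_apply, LinearMap.comp_apply, slotsToCyclic_single, one_smul,
    cyclicBoundary_mk, hochschildB_slotExponent, slotBoundary_single, map_sum, map_sum]
  refine Finset.sum_congr rfl fun i _ => ?_
  rw [slotsToCyclic_single, comp_pin _ _ (merge_zero m i), map_smul]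

theorem slotsToCyclic_of_crowded {m : ℕ} {c : SlotChain (Fin N) m}
    (hc : c ∈ crowdedChains N k m) : slotsToCyclic N k m c = 0 := by
  suffices h : crowdedChains N k m ≤ LinearMap.ker (slotsToCyclic N k m) from h hc
  rw [crowdedChains, Finsupp.supported_eq_span_single, Submodule.span_le]
  rintro _ ⟨g, hg, rfl⟩
  have hg' : Crowded k (pin g) := hg
  rw [SetLike.mem_coe, LinearMap.mem_ker, slotsToCyclic_single, monomialTensor_of_crowded hg',
    map_zero, smul_zero]

/-- In the cyclic quotient every distribution equals, up to the cyclic sign, its rotation with the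
first variable in slot `0`; hence `slotsToCyclic` reaches all multilinear chains. -/
theorem slotsToCyclic_unpinChain {m : ℕ} (f : Fin (N + 1) → Fin (m + 1)) :
    slotsToCyclic N k m (unpinChain N m (Finsupp.single f 1)) =
      cyclicMk ℂ (EdgeRing (completeUniform (N + 1) k)) m (monomialTensor (N + 1) k (slotExponent f)) := by
  obtain ⟨j, hj⟩ : ∃ j, (f 0 : ℕ) = j := ⟨_, rfl⟩
  induction j generalizing f with
  | zero =>
    have hf : f = pin (Fin.tail f) := by
      rw [pin, ← show f 0 = 0 from Fin.ext hj, Fin.cons_self_tail]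
    rw [hf, unpinChain_single_pin, slotsToCyclic_single, one_smul]
  | succ j ih =>
    have hf : f = fun x => (f x - 1) + 1 := by
      funext x
      simp
    have hval : ((f 0 - 1 : Fin (m + 1)) : ℕ) = j := by
      have h1 : ((f 0 - 1 : Fin (m + 1)) + 1 : Fin (m + 1)) = f 0 := by simp
      have h2 := Fin.val_add_one (f 0 - 1)
      rw [h1, hj] at h2
      split_ifs at h2
      omega
    rw [hf, unpinChain_rotate, map_smul, ih _ hval, ← cyclicMk_cyclicT, cyclicT_slotExponent,
      map_smul, smul_smul, ← pow_add, Even.neg_one_pow ⟨m, rfl⟩, one_smul]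

theorem map_multilinearChains (m : ℕ) :
    (multilinearChains (completeUniform (N + 1) k) m).map (cyclicRelations ℂ (EdgeRing (completeUniform (N + 1) k)) m).mkQ =
      LinearMap.range (slotsToCyclic N k m) := by
  apply le_antisymm
  · rw [multilinearChains, Submodule.map_span_le]
    rintro _ ⟨d, hd, rfl⟩
    obtain ⟨f, rfl⟩ := exists_eq_slotExponent hd
    exact ⟨_, slotsToCyclic_unpinChain f⟩
  · rintro _ ⟨c, rfl⟩
    rw [slotsToCyclic, Finsupp.linearCombination_apply]
    refine Submodule.sum_mem _ fun g _ => Submodule.smul_mem _ _ (Submodule.mem_map_of_mem ?_)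
    exact Submodule.subset_span ⟨_, sum_slotExponent _, rfl⟩

/-- The quotient of `C` by `B ⊓ C` embeds in `V ⧸ B`, where both images can be compared. -/
theorem finrank_map_submoduleOf {R V : Type*} [CommRing R] [AddCommGroup V] [Module R V]
    (M C B : Submodule R V) :
    Module.finrank R ((M.submoduleOf C).map (B.submoduleOf C).mkQ) =
      Module.finrank R ((M ⊓ C).map B.mkQ) := by
  let φ : (C ⧸ B.submoduleOf C) →ₗ[R] V ⧸ B := Submodule.mapQ _ _ C.subtype le_rfl
  have hφ : Function.Injective φ := by
    rw [injective_iff_map_eq_zero]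
    intro x hx
    obtain ⟨x, rfl⟩ := Submodule.mkQ_surjective _ x
    rw [Submodule.mkQ_apply, Submodule.Quotient.mk_eq_zero]
    exact (Submodule.Quotient.mk_eq_zero B).1 hx
  have h : ((M.submoduleOf C).map (B.submoduleOf C).mkQ).map φ = (M ⊓ C).map B.mkQ := by
    rw [← Submodule.map_comp]
    have hc : φ ∘ₗ (B.submoduleOf C).mkQ = B.mkQ ∘ₗ C.subtype := rfl
    rw [hc, Submodule.map_comp, Submodule.submoduleOf, Submodule.map_comap_subtype, inf_comm]
  rw [← h]
  exact (LinearEquiv.finrank_eq (Submodule.equivMapOfInjective φ hφ _))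

theorem finrank_multilinearHC (r : ℕ) :
    Module.finrank ℂ (multilinearHC (completeUniform (N + 1) k) (r + 1)) =
      Module.finrank ℂ (relHomology N k r) := by
  rw [multilinearHC, finrank_map_submoduleOf, map_multilinearChains,
    finrank_relHomology ((cyclicBoundaries ℂ (EdgeRing (completeUniform (N + 1) k)) (r + 1)).mkQ ∘ₗ slotsToCyclic N k (r + 1))]
  · have hs : LinearMap.range (slotsToCyclic N k (r + 1)) ⊓
        cyclicCycles ℂ (EdgeRing (completeUniform (N + 1) k)) (r + 1) =
        (relCycles N k r).map (slotsToCyclic N k (r + 1)) := by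
      ext x
      constructor
      · rintro ⟨⟨c, rfl⟩, hc⟩
        refine ⟨c, ?_, rfl⟩
        have hc' : cyclicBoundary ℂ (EdgeRing (completeUniform (N + 1) k)) r (slotsToCyclic N k (r + 1) c) = 0 := hc
        have h := cyclicToSlots_cyclicBoundary (slotsToCyclic N k (r + 1) c)
        rw [hc', map_zero, cyclicToSlots_slotsToCyclic, relBoundaryMap_mkQ, eq_comm,
          Submodule.mkQ_apply, Submodule.Quotient.mk_eq_zero] at h
        exact h
      · rintro ⟨c, hc, rfl⟩
        refine ⟨⟨c, rfl⟩, ?_⟩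
        change cyclicBoundary ℂ (EdgeRing (completeUniform (N + 1) k)) r (slotsToCyclic N k (r + 1) c) = 0
        rw [cyclicBoundary_slotsToCyclic, slotsToCyclic_of_crowded hc]
    rw [Submodule.map_comp, hs]
  · intro c _
    rw [LinearMap.comp_apply, Submodule.mkQ_apply, Submodule.Quotient.mk_eq_zero]
    constructor
    -- The chain `y` need not be multilinear; `cyclicToSlots` projects it to the multilinear part
    -- and commutes with the differentials.
    · rintro ⟨y, hy⟩
      have h := cyclicToSlots_cyclicBoundary y
      rw [hy, cyclicToSlots_slotsToCyclic] at h
      obtain ⟨w, hw⟩ := Submodule.mkQ_surjective _ (cyclicToSlots N k (r + 2) y)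
      rw [← hw, relBoundaryMap_mkQ, ← sub_eq_zero, ← map_sub, Submodule.mkQ_apply,
        Submodule.Quotient.mk_eq_zero] at h
      exact Submodule.mem_sup.2 ⟨_, h, _, ⟨w, rfl⟩, sub_add_cancel _ _⟩
    · intro hc
      obtain ⟨y, hy, _, ⟨z, rfl⟩, rfl⟩ := Submodule.mem_sup.1 hc
      refine ⟨slotsToCyclic N k (r + 2) z, ?_⟩
      rw [map_add, slotsToCyclic_of_crowded hy, zero_add, cyclicBoundary_slotsToCyclic]

end Transfer

end CyclicHom

/-! ### The dimension formulas -/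

theorem corollary3p3 (n k : ℕ) (hk : 3 ≤ k) :
    (∀ r : ℕ, (n : ℤ) - k < r → (r : ℤ) ≤ n - 2 →
      Module.finrank ℂ (CyclicHom.multilinearHC (CyclicHom.completeUniform n k) (r + 1)) =
        CyclicHom.binom (n - 1) (r + 1)) ∧
    (∀ r : ℕ, (r : ℤ) = n - k →
      Module.finrank ℂ (CyclicHom.multilinearHC (CyclicHom.completeUniform n k) (r + 1)) =
        CyclicHom.binom (n - 1) (n - k - 1) + CyclicHom.binom (n - 1) (n - k + 1)) := by
  refine ⟨fun r h1 h2 => ?_, fun r hr => ?_⟩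
  · obtain ⟨N, rfl⟩ : ∃ N, n = N + 1 := ⟨n - 1, by omega⟩
    rw [CyclicHom.finrank_multilinearHC, CyclicHom.finrank_relHomology_of_lt (by omega),
      CyclicHom.binom, if_pos (by omega)]
    congr 1
  · obtain ⟨N, rfl⟩ : ∃ N, n = N + 1 := ⟨n - 1, by omega⟩
    have h := CyclicHom.finrank_relHomology_of_eq hk (show N + 1 = k + r by omega)
    rw [CyclicHom.finrank_multilinearHC, ← hr, CyclicHom.binom, CyclicHom.binom,
      if_pos (show (0 : ℤ) ≤ (r : ℤ) + 1 by omega), Nat.add_sub_cancel]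
    have h1 : ((r : ℤ) + 1).toNat = r + 1 := by omega
    rw [h1]
    cases r with
    -- For `r = 0` the lower index `-1` gives `0` by convention, while `(N + 1).choose 0` and
    -- `N.choose 0` cancel. For `r > 0` the same is done by Pascal's rule.
    | zero =>
      rw [if_neg (by norm_num)]
      simpa using h
    | succ s =>
      have h2 : (((s + 1 : ℕ) : ℤ) - 1).toNat = s := by omega
      rw [if_pos (by omega), h2]
      rw [Nat.choose_succ_succ' N s] at h
      omega
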